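/- An instance of house allocation consists of $n \ge 0$ agents, $m \ge n$ houses, and nonnegative rational utilities $u_a(h)$, one for each agent $a$ and house $h$. An assignment is an injection $\phi$ from the agents to the houses; it is equitable if $u_a(\phi(a)) = u_{a'}(\phi(a'))$ for all agents $a, a'$. An instance is presented as a string over a finite alphabet that lists $n$, $m$ and the utilities row by row, the numbers being written in binary and each utility as a fraction in lowest terms. Theorem. There is a polynomial-time algorithm (a deterministic multi-stack Turing machine whose number of steps is at most a fixed polynomial in the length of the input string) that, given any instance, decides whether an equitable assignment exists. Moreover, for every instance with $n \ge 1$, an equitable assignment exists if and only if there is a utility value $k \in \{u_a(h)\}$ such that the bipartite graph between agents and houses, in which $a$ and $h$ are adjacent exactly when $u_a(h) = k$, has a matching that covers all agents. -/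

import Mathlib

/-- An instance of house allocation: `n` agents, `m ≥ n` houses, and for each agent `a` and house
`h` a nonnegative utility `u a h`.  Utilities are rational, so that an instance is a finite object
that can be handed to a machine. -/
structure HouseInstance where
  /-- number of agents -/
  n : ℕ
  /-- number of houses -/
  m : ℕ
  /-- there are at least as many houses as agents -/
  n_le_m : n ≤ m
  /-- utility of an agent for a house -/
  u : Fin n → Fin m → ℚ≥0

namespace HouseInstance

/-- An assignment (house allocation) is an injection from the agents to the houses. -/
abbrev Assignment (I : HouseInstance) : Type := Fin I.n ↪ Fin I.m

/-- An assignment is equitable if all agents have the same utility for their own house. -/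
def IsEquitable (I : HouseInstance) (φ : I.Assignment) : Prop :=
  ∀ a a' : Fin I.n, I.u a (φ a) = I.u a' (φ a')

/-- The instance admits an equitable assignment. -/
def HasEquitable (I : HouseInstance) : Prop :=
  ∃ φ : I.Assignment, I.IsEquitable φ

open Classical in
/-- The decision problem: the answer is `true` exactly if an equitable assignment exists. -/
noncomputable def equitableDecision (I : HouseInstance) : Bool :=
  decide I.HasEquitable

/-- The bipartite graph of agents (left) and houses (right) in which `a` and `h` are adjacent
exactly if `a` has utility exactly `k` for `h`. -/
def utilityGraph (I : HouseInstance) (k : ℚ≥0) : SimpleGraph (Fin I.n ⊕ Fin I.m) :=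
  SimpleGraph.fromRel fun x y => ∃ a h, x = Sum.inl a ∧ y = Sum.inr h ∧ I.u a h = k

/-! ### The instance as a string

Numbers are written in binary, a utility as its numerator and denominator in lowest terms,
`[num,den]`; the string of an instance is `n,m,` followed by one bracketed row `[[p,q]…[p,q]]`
for each agent. -/

open Computability

/-- A natural number in binary. -/
def encodeBits (k : ℕ) : List Γ' := (encodeNat k).map Γ'.bit

/-- A utility `p / q` in lowest terms, as the string `[p,q]`. -/
def encodeUtility (q : ℚ≥0) : List Γ' :=
  Γ'.bra :: (encodeBits q.num ++ Γ'.comma :: (encodeBits q.den ++ [Γ'.ket]))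

/-- The row of utilities of an agent. -/
def encodeRow {m : ℕ} (v : Fin m → ℚ≥0) : List Γ' :=
  Γ'.bra :: ((List.ofFn v).flatMap encodeUtility ++ [Γ'.ket])

/-- The string that presents an instance to a machine. -/
def encode (I : HouseInstance) : List Γ' :=
  encodeBits I.n ++ Γ'.comma ::
    (encodeBits I.m ++ Γ'.comma :: (List.ofFn I.u).flatMap encodeRow)

/-! The string determines the instance. -/

theorem encodeBits_append {k k' : ℕ} {c : Γ'} (hc : ∀ b, c ≠ Γ'.bit b) {s t : List Γ'}
    (h : encodeBits k ++ c :: s = encodeBits k' ++ c :: t) : k = k' ∧ s = t := by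
  have key : ∀ l l' : List Bool, l.map Γ'.bit ++ c :: s = l'.map Γ'.bit ++ c :: t →
      l = l' ∧ s = t := by
    intro l
    induction l with
    | nil =>
      intro l' h
      cases l' with
      | nil => simpa using h
      | cons b l' => simp [hc b] at h
    | cons a l ih =>
      intro l' h
      cases l' with
      | nil => simp [(hc a).symm] at h
      | cons b l' =>
        simp only [List.map_cons, List.cons_append, List.cons.injEq, Γ'.bit.injEq] at h
        obtain ⟨h1, h2⟩ := ih l' h.2
        exact ⟨by rw [h.1, h1], h2⟩
  obtain ⟨h1, h2⟩ := key _ _ h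
  exact ⟨encodingNatBool.encode_injective h1, h2⟩

theorem flatMap_append {α : Type*} {f : α → List Γ'}
    (hf : ∀ a b s t, f a ++ s = f b ++ t → a = b ∧ s = t) (l l' : List α)
    (hl : l.length = l'.length) {s t : List Γ'}
    (h : l.flatMap f ++ s = l'.flatMap f ++ t) : l = l' ∧ s = t := by
  induction l generalizing l' with
  | nil =>
    obtain rfl : l' = [] := List.length_eq_zero_iff.1 hl.symm
    simpa using h
  | cons a l ih =>
    cases l' with
    | nil => simp at hl
    | cons b l' =>
      simp only [List.flatMap_cons, List.append_assoc] at h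
      obtain ⟨rfl, h1⟩ := hf _ _ _ _ h
      obtain ⟨rfl, h2⟩ := ih l' (by simpa using hl) h1
      exact ⟨rfl, h2⟩

theorem encodeUtility_append (p q : ℚ≥0) (s t : List Γ')
    (h : encodeUtility p ++ s = encodeUtility q ++ t) : p = q ∧ s = t := by
  simp only [encodeUtility, List.cons_append, List.append_assoc, List.nil_append,
    List.cons.injEq, true_and] at h
  obtain ⟨h1, h2⟩ := encodeBits_append (by simp) h
  obtain ⟨h3, h4⟩ := encodeBits_append (by simp) h2
  exact ⟨NNRat.ext_num_den h1 h3, h4⟩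

theorem encodeRow_append {m : ℕ} (v w : Fin m → ℚ≥0) (s t : List Γ')
    (h : encodeRow v ++ s = encodeRow w ++ t) : v = w ∧ s = t := by
  simp only [encodeRow, List.cons_append, List.append_assoc, List.nil_append,
    List.cons.injEq, true_and] at h
  obtain ⟨h1, h2⟩ := flatMap_append encodeUtility_append _ _ (by simp) h
  exact ⟨List.ofFn_injective h1, by simpa using h2⟩

theorem encode_injective : Function.Injective encode := by
  rintro ⟨n, m, hnm, u⟩ ⟨n', m', hnm', u'⟩ h
  simp only [encode] at h
  obtain ⟨rfl, h1⟩ := encodeBits_append (by simp) h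
  obtain ⟨rfl, h2⟩ := encodeBits_append (by simp) h1
  obtain ⟨h3, -⟩ := flatMap_append (s := []) (t := []) encodeRow_append
    (List.ofFn u) (List.ofFn u') (by simp) (by simpa using h2)
  rw [List.ofFn_injective h3]

end HouseInstance

/-! If there is an agent, an equitable assignment gives everybody one common utility `k`. This `k`
is one of the values listed in the input, and the assignment is a matching that covers all agents in
the graph of the pairs of utility `k`. This gives the characterisation
(`HouseInstance.hasEquitable_iff`) and reduces the decision to one bipartite matching problem for
each listed utility.

Matchings are found by an auction, which needs no search for augmenting paths. Houses have prices,
initially zero. An agent without a house takes a cheapest house that it accepts, evicts the owner,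
and the price grows by one. Two invariants carry the proof: a house of positive price is owned, and
the price of an owned house exceeds the price of any other house accepted by its owner by at most
one. Suppose that all houses accepted by a homeless agent `a₀` have price at least `N ≥ n`, and let
`T j` be the set of houses of price larger than `j`. A matching that covers all agents would map the
owners of `T (j + 1)`, together with `a₀`, injectively into `T j`, so `T 0` would have at least `N`
houses, with `N` distinct owners other than `a₀`: too many agents (`Auction.not_hasMatching`).
Otherwise each round with a homeless agent raises the sum of the prices, which is at most `m * N`.
With `m < N`, the auction is settled after `N * N` rounds (`HouseProgram.run_auction`).

The running time is obtained once and for all from a restricted language. An array program has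
two-dimensional arrays of symbols, variables with values up to the input length `N`, and loops only
over the numbers below `N`; hence it terminates, and its cost is polynomial in `N`
(`exists_polynomial_cost`). It is compiled to a while program on stacks (`exists_exec_compile`), and
this to a multi-stack machine (`Exec.steps_le`). Such small variables suffice because the string has
a symbol for each of the `n * m` utilities. The procedure never decodes a number: agents and houses
are counted by brackets, and utilities are compared as strings, which is correct since fractions in
lowest terms have unique strings. -/

section

open Computability Function

/-! ### While programs on stacks and their machines -/

namespace StackProgram

variable {K : Type}

/-- While programs whose variables are stacks of symbols, indexed by `K`. -/
inductive Com (K : Type) : Type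
  | skip : Com K
  | push : K → Γ' → Com K
  | pop : K → Com K
  /-- move the top symbol of the first stack (a blank if it is empty) to the second stack -/
  | move : K → K → Com K
  /-- branch on the top symbol of a stack -/
  | ite : K → (Option Γ' → Bool) → Com K → Com K → Com K
  /-- repeat while the stack is nonempty -/
  | loop : K → Com K → Com K
  | seq : Com K → Com K → Com K

/-- The contents of the stacks. -/
abbrev Store (K : Type) : Type := K → List Γ'

/-- The effect of `Com.move`. -/
def mv [DecidableEq K] (k k' : K) (S : Store K) : Store K :=
  update (update S k (S k).tail) k' ((S k).headD Γ'.blank :: update S k (S k).tail k')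

/-- `Exec P S S' t`: the program `P`, started in the store `S`, ends in `S'` after at most `t`
steps. -/
inductive Exec [DecidableEq K] : Com K → Store K → Store K → ℕ → Prop
  | skip (S : Store K) : Exec .skip S S 1
  | push (k : K) (s : Γ') (S : Store K) : Exec (.push k s) S (update S k (s :: S k)) 1
  | pop (k : K) (S : Store K) : Exec (.pop k) S (update S k (S k).tail) 1
  | move (k k' : K) (S : Store K) : Exec (.move k k') S (mv k k' S) 1
  | iteTrue {k : K} {p : Option Γ' → Bool} {P Q : Com K} {S S' : Store K} {t : ℕ} :
      p (S k).head? = true → Exec P S S' t → Exec (.ite k p P Q) S S' (t + 1)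
  | iteFalse {k : K} {p : Option Γ' → Bool} {P Q : Com K} {S S' : Store K} {t : ℕ} :
      p (S k).head? = false → Exec Q S S' t → Exec (.ite k p P Q) S S' (t + 1)
  | loopNil {k : K} {P : Com K} {S : Store K} : S k = [] → Exec (.loop k P) S S 1
  | loopCons {k : K} {P : Com K} {S S' S'' : Store K} {t t' : ℕ} : S k ≠ [] →
      Exec P S S' t → Exec (.loop k P) S' S'' t' → Exec (.loop k P) S S'' (t + t' + 1)
  | seq {P Q : Com K} {S S' S'' : Store K} {t t' : ℕ} :
      Exec P S S' t → Exec Q S' S'' t' → Exec (.seq P Q) S S'' (t + t')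
  | mono {P : Com K} {S S' : Store K} {t t' : ℕ} : Exec P S S' t → t ≤ t' → Exec P S S' t'

/-! ### Compilation to a multi-stack Turing machine -/

/-- The labels of the machine that executes a program. -/
def Com.Lab : Com K → Type
  | .skip | .push _ _ | .pop _ | .move _ _ => Unit
  | .ite _ _ P Q => Option (P.Lab ⊕ Q.Lab)
  | .loop _ P => Option P.Lab
  | .seq P Q => P.Lab ⊕ Q.Lab

noncomputable instance Com.fintypeLab : ∀ P : Com K, Fintype P.Lab
  | .skip | .push _ _ | .pop _ | .move _ _ => inferInstanceAs (Fintype Unit)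
  | .ite _ _ P Q =>
    have := fintypeLab P
    have := fintypeLab Q
    inferInstanceAs (Fintype (Option (P.Lab ⊕ Q.Lab)))
  | .loop _ P =>
    have := fintypeLab P
    inferInstanceAs (Fintype (Option P.Lab))
  | .seq P Q =>
    have := fintypeLab P
    have := fintypeLab Q
    inferInstanceAs (Fintype (P.Lab ⊕ Q.Lab))

/-- The entry point of a program. -/
def Com.start : ∀ P : Com K, P.Lab
  | .skip | .push _ _ | .pop _ | .move _ _ => ()
  | .ite _ _ _ _ => (none : Option _)
  | .loop _ _ => (none : Option _)
  | .seq P _ => Sum.inl P.start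

/-- The alphabets of the stacks: one output stack besides those of the program. -/
abbrev Alphabet (K : Type) : Option K → Type
  | none => Bool
  | some _ => Γ'

/-- The statements of the machine that executes a program; `ι` embeds the labels of the program
into those of the machine, and `e` is the label at which execution continues. -/
def Com.code {Λ : Type} : ∀ P : Com K, (P.Lab → Λ) → Λ → P.Lab →
    Turing.TM2.Stmt (Alphabet K) Λ (Option Γ')
  | .skip, _, e, _ => .goto fun _ => e
  | .push k s, _, e, _ => .push (some k) (fun _ => s) (.goto fun _ => e)
  | .pop k, _, e, _ => .pop (some k) (fun _ _ => none) (.goto fun _ => e)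
  | .move k k', _, e, _ =>
    .pop (some k) (fun _ o => o) (.push (some k') (fun v => v.getD Γ'.blank)
      (.load (fun _ => none) (.goto fun _ => e)))
  | .ite k p P _, ι, _, none =>
    .peek (some k) (fun _ o => o) (.branch p
      (.load (fun _ => none) (.goto fun _ => ι (some (Sum.inl P.start))))
      (.load (fun _ => none) (.goto fun _ => ι (some (Sum.inr (Com.start _))))))
  | .ite _ _ P _, ι, e, some (Sum.inl l) => P.code (fun l => ι (some (Sum.inl l))) e l
  | .ite _ _ _ Q, ι, e, some (Sum.inr l) => Q.code (fun l => ι (some (Sum.inr l))) e l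
  | .loop k P, ι, e, none =>
    .peek (some k) (fun _ o => o) (.branch Option.isSome
      (.load (fun _ => none) (.goto fun _ => ι (some P.start)))
      (.load (fun _ => none) (.goto fun _ => e)))
  | .loop _ P, ι, _, some l => P.code (fun l => ι (some l)) (ι none) l
  | .seq P Q, ι, _, Sum.inl l => P.code (fun l => ι (Sum.inl l)) (ι (Sum.inr Q.start)) l
  | .seq _ Q, ι, e, Sum.inr l => Q.code (fun l => ι (Sum.inr l)) e l

/-- The stacks of the machine, given the store of the program and the output. -/
def tapes (S : Store K) (o : List Bool) : ∀ k : Option K, List (Alphabet K k)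
  | none => o
  | some k => S k

theorem tapes_some (S : Store K) (o : List Bool) (k : K) : tapes S o (some k) = S k := rfl

variable [DecidableEq K]

theorem update_tapes_some (S : Store K) (o : List Bool) (k : K) (l : List Γ') :
    update (tapes S o) (some k) l = tapes (update S k l) o := by
  funext k'
  cases k' with
  | none => simp [tapes]
  | some k' =>
    by_cases h : k' = k
    · subst h; simp [tapes]
    · rw [update_of_ne (by simpa using h)]
      simp [tapes, update_of_ne h]

theorem update_tapes_none (S : Store K) (o o' : List Bool) :
    update (tapes S o) none o' = tapes S o' := by
  funext k'
  cases k' with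
  | none => simp [tapes]
  | some k' => rw [update_of_ne (by simp)]; rfl

/-- `n` steps of the machine `M`. -/
def steps {Λ : Type} (M : Λ → Turing.TM2.Stmt (Alphabet K) Λ (Option Γ')) (n : ℕ)
    (c : Turing.TM2.Cfg (Alphabet K) Λ (Option Γ')) :
    Option (Turing.TM2.Cfg (Alphabet K) Λ (Option Γ')) :=
  (flip bind (Turing.TM2.step M))^[n] (some c)

theorem steps_one {Λ : Type} (M : Λ → Turing.TM2.Stmt (Alphabet K) Λ (Option Γ'))
    (c : Turing.TM2.Cfg (Alphabet K) Λ (Option Γ')) :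
    steps M 1 c = Turing.TM2.step M c := rfl

theorem steps_add {Λ : Type} {M : Λ → Turing.TM2.Stmt (Alphabet K) Λ (Option Γ')} {n n' : ℕ}
    {c c' : Turing.TM2.Cfg (Alphabet K) Λ (Option Γ')} (h : steps M n c = some c') :
    steps M (n + n') c = steps M n' c' := by
  unfold steps at *
  rw [add_comm, iterate_add_apply, h]

/-- The configuration in which the program store is `S` and nothing has been output. -/
abbrev config {Λ : Type} (l : Λ) (S : Store K) : Turing.TM2.Cfg (Alphabet K) Λ (Option Γ') :=
  ⟨some l, none, tapes S []⟩

/-- Induction on the execution. The register is reset to `none` before every jump, so runs of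
subprograms concatenate. A test costs one machine step and sequencing costs none. The body of a loop
has the exit `ι none`, the test of the loop, which is why `e` has to be arbitrary in the induction.
-/
theorem Exec.steps_le {Λ : Type} {M : Λ → Turing.TM2.Stmt (Alphabet K) Λ (Option Γ')}
    {P : Com K} {S S' : Store K} {t : ℕ} (h : Exec P S S' t) (ι : P.Lab → Λ) (e : Λ)
    (hM : ∀ l, M (ι l) = P.code ι e l) :
    ∃ n ≤ t, steps M n (config (ι P.start) S) = some (config e S') := by
  induction h generalizing e with
  | skip S =>
    refine ⟨1, le_rfl, ?_⟩
    simp [steps_one, config, hM, Com.code]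
  | push k s S =>
    refine ⟨1, le_rfl, ?_⟩
    simp [steps_one, config, hM, Com.code, update_tapes_some, tapes_some]
  | pop k S =>
    refine ⟨1, le_rfl, ?_⟩
    simp [steps_one, config, hM, Com.code, update_tapes_some, tapes_some]
  | move k k' S =>
    refine ⟨1, le_rfl, ?_⟩
    simp only [steps_one, config, hM, Com.code, Turing.TM2.step, Turing.TM2.stepAux]
    rw [tapes_some, update_tapes_some, tapes_some, update_tapes_some, mv, List.headD_eq_head?_getD]
  | @iteTrue k p P Q S S' t hp _ ih =>
    obtain ⟨n, hn, h⟩ := ih (fun l => ι (some (Sum.inl l))) e (fun l => hM (some (Sum.inl l)))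
    refine ⟨1 + n, by omega, ?_⟩
    rw [steps_add (c' := config (ι (some (Sum.inl P.start))) S), h]
    have := hM none
    simp only [Com.code] at this
    simp [steps_one, config, Com.start, this, tapes_some, hp]
  | @iteFalse k p P Q S S' t hp _ ih =>
    obtain ⟨n, hn, h⟩ := ih (fun l => ι (some (Sum.inr l))) e (fun l => hM (some (Sum.inr l)))
    refine ⟨1 + n, by omega, ?_⟩
    rw [steps_add (c' := config (ι (some (Sum.inr Q.start))) S), h]
    have := hM none
    simp only [Com.code] at this
    simp [steps_one, config, Com.start, this, tapes_some, hp]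
  | @loopNil k P S hk =>
    refine ⟨1, le_rfl, ?_⟩
    have := hM none
    simp only [Com.code] at this
    simp [steps_one, config, Com.start, this, tapes_some, hk]
  | @loopCons k P S S' S'' t t' hk _ _ ih ih' =>
    obtain ⟨n, hn, h⟩ := ih (fun l => ι (some l)) (ι none) (fun l => hM (some l))
    obtain ⟨n', hn', h'⟩ := ih' ι e hM
    refine ⟨1 + (n + n'), by omega, ?_⟩
    rw [steps_add (c' := config (ι (some P.start)) S), steps_add h]
    · exact h'
    · have := hM none
      simp only [Com.code] at this
      obtain ⟨s, l, hl⟩ := List.exists_cons_of_ne_nil hk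
      simp [steps_one, config, Com.start, this, tapes_some, hl]
  | @seq P Q S S' S'' t t' _ _ ih ih' =>
    obtain ⟨n, hn, h⟩ := ih (fun l => ι (Sum.inl l)) (ι (Sum.inr Q.start)) (fun l => hM (Sum.inl l))
    obtain ⟨n', hn', h'⟩ := ih' (fun l => ι (Sum.inr l)) e (fun l => hM (Sum.inr l))
    exact ⟨n + n', by omega, by rw [Com.start, steps_add h, h']⟩
  | mono _ ht ih =>
    obtain ⟨n, hn, h⟩ := ih ι e hM
    exact ⟨n, hn.trans ht, h⟩

/-- The statements of `machine`. -/
def machineCode (P : Com K) (kout : K) :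
    Option P.Lab → Turing.TM2.Stmt (Alphabet K) (Option P.Lab) (Option Γ')
  | some l => P.code some none l
  | none => .pop (some kout) (fun _ o => o) (.branch Option.isSome
      (.push none (fun _ => true) (.load (fun _ => none) .halt))
      (.push none (fun _ => false) (.load (fun _ => none) .halt)))

/-- The machine that executes `P`, with input on the stack `kin`, and then outputs whether the
stack `kout` is nonempty. -/
noncomputable abbrev machine [Fintype K] (P : Com K) (kin kout : K) : Turing.FinTM2 where
  K := Option K
  k₀ := some kin
  k₁ := none
  Γ := Alphabet K
  Λ := Option P.Lab
  main := some P.start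
  σ := Option Γ'
  initialState := none
  Γk₀Fin := inferInstanceAs (Fintype Γ')
  m := machineCode P kout

/-- The store at the start: a word on one stack. -/
def single (k : K) (w : List Γ') : Store K := update (fun _ => []) k w

/-- A decision problem is polynomial-time computable if a while program decides it in polynomial
time. -/
theorem nonempty_computableInPolyTime [Fintype K] {α : Type} (enc : α → List Γ') (f : α → Bool)
    (P : Com K) (kin kout : K) (time : Polynomial ℕ)
    (h : ∀ a, Exec P (single kin (enc a)) (single kout (if f a then [Γ'.blank] else []))
      (time.eval (enc a).length)) :
    Nonempty (Turing.TM2ComputableInPolyTime enc encodeBool f) := by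
  refine ⟨{ tm := machine P kin kout, inputAlphabet := Equiv.refl _, outputAlphabet := Equiv.refl _,
            time := time + 1, outputsFun := fun a => ?_ }⟩
  -- The additional step pops the answer from `kout` and writes the output bit, so that all stacks
  -- except the output are empty, as `haltList` requires.
  have key : ∃ n ≤ (time + 1).eval (enc a).length,
      steps (machineCode P kout) n (config (some P.start) (single kin (enc a))) =
        some ⟨none, none, tapes (fun _ => []) [f a]⟩ := by
    obtain ⟨n, hn, hs⟩ := (h a).steps_le (M := (machineCode P kout)) (fun l => some l) none
      (fun l => rfl)
    refine ⟨n + 1, by simpa using hn, ?_⟩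
    rw [steps_add hs, steps_one]
    cases f a <;> simp [config, machineCode, single, update_tapes_some,
      update_tapes_none, tapes]
  have h0 : Turing.initList (machine P kin kout) (List.map (Equiv.refl _).invFun (enc a)) =
      config (some P.start) (single kin (enc a)) := by
    simp only [Turing.initList, config, machine]
    congr 1
    funext k
    cases k with
    | none => rw [dif_neg (by simp)]; rfl
    | some k =>
      by_cases hk : k = kin
      · subst hk
        rw [dif_pos rfl]
        simp [tapes, single]
      · rw [dif_neg (by simpa using hk)]
        simp [tapes, single, update_of_ne hk]
  have h1 : Turing.haltList (machine P kin kout)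
      (List.map (Equiv.refl _).invFun (encodeBool (f a))) =
      ⟨none, none, tapes (fun _ => []) [f a]⟩ := by
    simp only [Turing.haltList, machine]
    congr 1
    funext k
    cases k with
    | none => rw [dif_pos rfl]; rfl
    | some k => rw [dif_neg (by simp)]; rfl
  rw [← h0, ← h1] at key
  exact ⟨⟨key.choose, key.choose_spec.2⟩, key.choose_spec.1⟩

end StackProgram

end

/-! ### Counting loops on stacks -/

section

open Computability Function

namespace StackProgram

variable {K : Type} [DecidableEq K]

theorem Exec.congr_right {P : Com K} {S S' S'' : Store K} {t : ℕ} (h : Exec P S S' t)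
    (h' : S' = S'') : Exec P S S'' t :=
  h' ▸ h

theorem mv_apply (k k' : K) (S : Store K) (j : K) (h : k ≠ k') :
    mv k k' S j = if j = k' then (S k).headD Γ'.blank :: S k' else
      if j = k then (S k).tail else S j := by
  simp only [mv, update_apply, if_neg h.symm]

theorem mv_fst {k k' : K} (h : k ≠ k') (S : Store K) : mv k k' S k = (S k).tail := by
  simp [mv_apply _ _ _ _ h, h]

theorem mv_snd {k k' : K} (h : k ≠ k') (S : Store K) :
    mv k k' S k' = (S k).headD Γ'.blank :: S k' := by
  simp [mv_apply _ _ _ _ h]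

theorem mv_of_ne {k k' j : K} (S : Store K) (h : j ≠ k) (h' : j ≠ k') :
    mv k k' S j = S j := by
  simp [mv, update_of_ne, h, h']

theorem iterate_mv_of_ne {k k' j : K} (n : ℕ) (S : Store K) (h : j ≠ k) (h' : j ≠ k') :
    (mv k k')^[n] S j = S j := by
  induction n generalizing S with
  | zero => rfl
  | succ n ih => rw [iterate_succ_apply, ih, mv_of_ne S h h']

theorem iterate_mv_fst {k k' : K} (h : k ≠ k') (n : ℕ) (S : Store K) :
    (mv k k')^[n] S k = (S k).drop n := by
  induction n generalizing S with
  | zero => rfl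
  | succ n ih => rw [iterate_succ_apply, ih, mv_fst h, List.drop_tail]

theorem iterate_mv_snd {k k' : K} (h : k ≠ k') {n l : ℕ} {S : Store K}
    (hS : S k = List.replicate (n + l) Γ'.blank) :
    (mv k k')^[n] S k' = List.replicate n Γ'.blank ++ S k' := by
  induction n generalizing S with
  | zero => rfl
  | succ n ih =>
    have h1 : S k = Γ'.blank :: List.replicate (n + l) Γ'.blank := by
      rw [hS, ← List.replicate_succ]; congr 1; omega
    rw [iterate_succ_apply, ih (by rw [mv_fst h, h1]; rfl), mv_snd h, h1, List.replicate_succ']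
    simp

/-- Moves on disjoint pairs of stacks are independent. In `exec_times` one pair is the loop counter
and the other belongs to the loop body. -/
theorem commute_mv {a b c d : K} (hab : a ≠ b) (hcd : c ≠ d) (hac : a ≠ c) (had : a ≠ d)
    (hbc : b ≠ c) (hbd : b ≠ d) : Function.Commute (mv a b : Store K → Store K) (mv c d) := by
  intro S
  funext j
  simp only [mv_apply _ _ _ _ hab, mv_apply _ _ _ _ hcd]
  by_cases h1 : j = a
  · subst h1; simp [hab, hac, had]
  by_cases h2 : j = b
  · subst h2; simp [hbc, hbd, hac, had]
  by_cases h3 : j = c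
  · subst h3; simp [hcd, Ne.symm hbc, Ne.symm hac]
  by_cases h4 : j = d
  · subst h4; simp [Ne.symm hbd, Ne.symm had, hbc.symm, hac.symm]
  simp [h1, h2, h3, h4]

/-- Moving symbols back after the top of the stack has been replaced. -/
theorem iterate_mv_update {k k' : K} (h : k ≠ k') (n : ℕ) (S : Store K) (l : List Γ') :
    (mv k' k)^[n] (update ((mv k k')^[n] S) k l) =
      update S k ((S k).takeD n Γ'.blank ++ l) := by
  -- A move from an empty stack delivers a blank, so a stack shorter than `n` comes back padded with
  -- blanks; hence `takeD`.
  induction n generalizing S with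
  | zero => simp
  | succ n ih =>
    rw [iterate_succ_apply', iterate_succ_apply, ih]
    funext j
    rw [mv_apply _ _ _ _ h.symm]
    by_cases h1 : j = k
    · subst h1
      cases hS : S j <;> simp [hS, mv_apply _ _ _ _ h, h, List.takeD, h.symm]
    · by_cases h2 : j = k'
      · subst h2
        simp [mv_apply _ _ _ _ h, h.symm]
      · simp [h1, h2, mv_apply _ _ _ _ h]

/-- With at least `n` symbols on the stack there is no padding, and the round trip is the identity.
-/
theorem iterate_mv_mv {k k' : K} (h : k ≠ k') {n : ℕ} {S : Store K} (hn : n ≤ (S k).length) :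
    (mv k' k)^[n] ((mv k k')^[n] S) = S := by
  have := iterate_mv_update h n S ((S k).drop n)
  rw [← iterate_mv_fst h, update_eq_self] at this
  rw [this, List.takeD_eq_take _ hn, iterate_mv_fst h, List.take_append_drop, update_eq_self]

theorem exec_loop_mv {k k' : K} (h : k ≠ k') {n : ℕ} {S : Store K} (hS : (S k).length = n) :
    Exec (.loop k (.move k k')) S ((mv k k')^[n] S) (2 * n + 1) := by
  induction n generalizing S with
  | zero => exact .loopNil (List.length_eq_zero_iff.1 hS)
  | succ n ih =>
    refine .mono (.loopCons (by rintro h; simp [h] at hS) (.move k k' S)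
      (ih (by rw [mv_fst h]; simp [hS]))) (by omega)

/-- Execute a program as often as the height of the stack `k` tells, with `k'` as an auxiliary
stack. -/
def Com.times (k k' : K) (P : Com K) : Com K :=
  .seq (.loop k (.seq (.move k k') P)) (.loop k' (.move k' k))

/-- The first loop shifts the counter from `k` to `k'` and runs `P` once per symbol; the second
shifts it back. Since `f` commutes with the shift, all shifts can be collected at the end, where
they cancel. The invariant `J` carries the preconditions of `P`, such as the counters of a nested
loop. -/
theorem exec_times {k k' : K} (h : k ≠ k') {P : Com K} {f : Store K → Store K} {t : ℕ}
    (J : Store K → Prop) (hP : ∀ S, J S → Exec P S (f S) t) (hJ : ∀ S, J S → J (f S))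
    (hmv : ∀ S, J S → J (mv k k' S)) (hf : Function.Commute f (mv k k'))
    (hk : ∀ S, f S k = S k) (hk' : ∀ S, f S k' = S k') {n : ℕ} {S : Store K} (hS : J S)
    (hn : S k = List.replicate n Γ'.blank) (hnil : S k' = []) :
    Exec (Com.times k k' P) S (f^[n] S) (n * (t + 4) + 2) := by
  have hfk : ∀ (m : ℕ) (S : Store K), f^[m] S k = S k := fun m S => by
    induction m generalizing S with
    | zero => rfl
    | succ m ih => rw [iterate_succ_apply, ih, hk]
  have hfk' : ∀ (m : ℕ) (S : Store K), f^[m] S k' = S k' := fun m S => by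
    induction m generalizing S with
    | zero => rfl
    | succ m ih => rw [iterate_succ_apply, ih, hk']
  have first : ∀ (m : ℕ) (S : Store K), J S → S k = List.replicate m Γ'.blank →
      Exec (.loop k (.seq (.move k k') P)) S ((mv k k')^[m] (f^[m] S)) (m * (t + 2) + 1) := by
    intro m
    induction m with
    | zero => intro S _ hS; exact .mono (.loopNil (by simpa using hS)) (by omega)
    | succ m ih =>
      intro S hJS hS
      have := ih (f (mv k k' S)) (hJ _ (hmv _ hJS)) (by rw [hk, mv_fst h, hS]; rfl)
      rw [hf S, (hf.iterate_left m).eq, ← iterate_succ_apply] at this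
      exact .mono (.loopCons (by simp [hS, List.replicate_succ])
        (.seq (.move k k' S) (hP _ (hmv _ hJS))) (hf S ▸ this)) (by ring_nf; omega)
  have h1 := first n S hS hn
  have h2 : Exec (.loop k' (.move k' k)) ((mv k k')^[n] (f^[n] S)) (f^[n] S) (2 * n + 1) := by
    have := exec_loop_mv h.symm (n := n) (S := (mv k k')^[n] (f^[n] S)) (by
      rw [iterate_mv_snd h (l := 0) (by rw [hfk, hn]; rfl), hfk', hnil]; simp)
    rwa [iterate_mv_mv h (by rw [hfk, hn]; simp)] at this
  exact .mono (.seq h1 h2) (by ring_nf; omega)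

/-- Empty a list of stacks. -/
def Com.clear : List K → Com K
  | [] => .skip
  | k :: l => .seq (.loop k (.pop k)) (Com.clear l)

theorem exec_loop_pop (k : K) {n : ℕ} {S : Store K} (hS : (S k).length = n) :
    Exec (.loop k (.pop k)) S (update S k []) (2 * n + 1) := by
  induction n generalizing S with
  | zero =>
    have h0 := List.length_eq_zero_iff.1 hS
    rw [← h0, update_eq_self]
    exact .loopNil h0
  | succ n ih =>
    have := ih (S := update S k (S k).tail) (by simp [hS])
    rw [update_idem] at this
    exact .mono (.loopCons (by rintro h; simp [h] at hS) (.pop k S) this) (by omega)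

theorem exec_clear (l : List K) {B : ℕ} {S : Store K} (hB : ∀ k, (S k).length ≤ B) :
    Exec (Com.clear l) S (fun k => if k ∈ l then [] else S k) (l.length * (2 * B + 1) + 1) := by
  induction l generalizing S with
  | nil => simpa [Com.clear] using .mono (Exec.skip S) (by omega)
  | cons k l ih =>
    have h1 := exec_loop_pop k (S := S) rfl
    have h2 := ih (S := update S k []) (fun j => by
      by_cases h : j = k
      · subst h; simp
      · rw [update_of_ne h]; exact hB j)
    have h3 : (fun j => if j ∈ l then [] else update S k [] j) =
        fun j => if j ∈ k :: l then [] else S j := by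
      funext j
      by_cases h : j = k
      · subst h; simp
      · simp [h]
    rw [h3] at h2
    refine .mono (.seq h1 h2) ?_
    have := hB k
    simp only [List.length_cons]
    ring_nf
    omega

/-- Push a blank on each of a list of stacks. -/
def Com.tick : List K → Com K
  | [] => .skip
  | k :: l => .seq (.push k Γ'.blank) (Com.tick l)

/-- Without repetitions in `l`, each of its stacks receives exactly one blank. -/
theorem exec_tick (l : List K) (hl : l.Nodup) (S : Store K) :
    Exec (Com.tick l) S (fun k => if k ∈ l then Γ'.blank :: S k else S k) (l.length + 1) := by
  induction l generalizing S with
  | nil => simpa [Com.tick] using .skip S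
  | cons k l ih =>
    have h2 := ih (List.nodup_cons.1 hl).2 (update S k (Γ'.blank :: S k))
    have h3 : (fun j => if j ∈ l then Γ'.blank :: update S k (Γ'.blank :: S k) j else
        update S k (Γ'.blank :: S k) j) =
        fun j => if j ∈ k :: l then Γ'.blank :: S j else S j := by
      funext j
      by_cases h : j = k
      · subst h; simp [(List.nodup_cons.1 hl).1]
      · simp [h]
    rw [h3] at h2
    exact .mono (.seq (.push k Γ'.blank S) h2) (by simp; omega)

end StackProgram

end

/-! ### Array programs and their compilation to stacks -/

section

open Computability Function

namespace ArrayProgram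

open StackProgram (Com Store Exec mv)

variable {R V : Type}

/-- Programs that compute with two-dimensional arrays of symbols, named by `R`, and with numbers in
`0, …, N`, named by `V`; the arrays are indexed by these variables. -/
inductive Prog (R V : Type) : Type
  | skip : Prog R V
  /-- assign a symbol to an array element -/
  | set : R → V → V → Γ' → Prog R V
  /-- branch on an array element -/
  | tst : R → V → V → (Γ' → Bool) → Prog R V → Prog R V → Prog R V
  /-- increment a variable, unless it is `N` -/
  | inc : V → Prog R V
  /-- set a variable to zero -/
  | reset : V → Prog R V
  /-- execute a program for all values below `N` of a variable -/
  | forEach : V → Prog R V → Prog R V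
  | seq : Prog R V → Prog R V → Prog R V

/-- The values of the arrays and variables. -/
@[ext]
structure State (R V : Type) where
  /-- the arrays -/
  A : R → ℕ → ℕ → Γ'
  /-- the variables -/
  v : V → ℕ

/-- Apply `f 0`, …, `f (n - 1)`, in this order. -/
def iter {S : Type} (f : ℕ → S → S) : ℕ → S → S
  | 0, s => s
  | n + 1, s => f n (iter f n s)

variable [DecidableEq R] [DecidableEq V]

/-- Assign a symbol to an array element. -/
def State.setA (s : State R V) (r : R) (i j : ℕ) (c : Γ') : State R V :=
  ⟨fun r' i' j' => if r' = r ∧ i' = i ∧ j' = j then c else s.A r' i' j', s.v⟩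

/-- Assign a number to a variable. -/
def State.setV (s : State R V) (x : V) (n : ℕ) : State R V :=
  ⟨s.A, update s.v x n⟩

/-- The effect of a program. -/
def run (N : ℕ) : Prog R V → State R V → State R V
  | .skip, s => s
  | .set r x y c, s => s.setA r (s.v x) (s.v y) c
  | .tst r x y p P Q, s => if p (s.A r (s.v x) (s.v y)) then run N P s else run N Q s
  | .inc x, s => s.setV x (min (s.v x + 1) N)
  | .reset x, s => s.setV x 0
  | .forEach x P, s => (iter (fun i s => run N P (s.setV x i)) N s).setV x 0
  | .seq P Q, s => run N Q (run N P s)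

/-- Whether a program changes an array. -/
def Prog.writes (r : R) : Prog R V → Bool
  | .skip | .inc _ | .reset _ => false
  | .set r' _ _ _ => r = r'
  | .tst _ _ _ _ P Q | .seq P Q => P.writes r || Q.writes r
  | .forEach _ P => P.writes r

/-- Whether a program changes a variable. -/
def Prog.assigns (x : V) : Prog R V → Bool
  | .skip | .set _ _ _ _ => false
  | .inc y | .reset y => x = y
  | .tst _ _ _ _ P Q | .seq P Q => P.assigns x || Q.assigns x
  | .forEach y P => x = y || P.assigns x

/-- No loop changes its own variable. -/
def Prog.wf : Prog R V → Bool
  | .skip | .set _ _ _ _ | .inc _ | .reset _ => true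
  | .tst _ _ _ _ P Q | .seq P Q => P.wf && Q.wf
  | .forEach x P => !P.assigns x && P.wf

theorem iter_induction {S : Type} {f : ℕ → S → S} (p : ℕ → S → Prop) {n : ℕ} {s : S}
    (h0 : p 0 s) (hs : ∀ i s, i < n → p i s → p (i + 1) (f i s)) : p n (iter f n s) := by
  have : ∀ m ≤ n, p m (iter f m s) := by
    intro m
    induction m with
    | zero => exact fun _ => h0
    | succ m ih => exact fun h => hs m _ h (ih (by omega))
  exact this n le_rfl

/-- Frame rule. Since `writes` is a computable syntactic check, its hypothesis holds by `rfl` for a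
concrete program; likewise for `assigns` below. -/
theorem run_A_of_not_writes {N : ℕ} {r : R} : ∀ {P : Prog R V}, P.writes r = false →
    ∀ s, (run N P s).A r = s.A r
  | .skip, _, s => rfl
  | .set r' x y c, h, s => by
    funext i j
    simp only [Prog.writes, decide_eq_false_iff_not] at h
    simp [run, State.setA, h]
  | .tst r' x y p P Q, h, s => by
    simp only [Prog.writes, Bool.or_eq_false_iff] at h
    simp only [run]
    split
    · exact run_A_of_not_writes h.1 s
    · exact run_A_of_not_writes h.2 s
  | .inc x, _, s => rfl
  | .reset x, _, s => rfl
  | .forEach x P, h, s => by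
    refine iter_induction (fun _ (s' : State R V) => s'.A r = s.A r) rfl (fun i s' _ h' => ?_)
    rw [run_A_of_not_writes (by simpa [Prog.writes] using h)]
    exact h'
  | .seq P Q, h, s => by
    simp only [Prog.writes, Bool.or_eq_false_iff] at h
    rw [run, run_A_of_not_writes h.2, run_A_of_not_writes h.1]

theorem run_v_of_not_assigns {N : ℕ} {x : V} : ∀ {P : Prog R V}, P.assigns x = false →
    ∀ s, (run N P s).v x = s.v x
  | .skip, _, s => rfl
  | .set r' x y c, h, s => rfl
  | .tst r' x y p P Q, h, s => by
    simp only [Prog.assigns, Bool.or_eq_false_iff] at h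
    simp only [run]
    split
    · exact run_v_of_not_assigns h.1 s
    · exact run_v_of_not_assigns h.2 s
  | .inc y, h, s => by
    simp only [Prog.assigns, decide_eq_false_iff_not] at h
    simp [run, State.setV, h]
  | .reset y, h, s => by
    simp only [Prog.assigns, decide_eq_false_iff_not] at h
    simp [run, State.setV, h]
  | .forEach y P, h, s => by
    simp only [Prog.assigns, Bool.or_eq_false_iff, decide_eq_false_iff_not] at h
    have : (iter (fun i s => run N P (s.setV y i)) N s).v x = s.v x := by
      refine iter_induction (fun _ (s' : State R V) => s'.v x = s.v x) rfl (fun i s' _ h' => ?_)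
      rw [run_v_of_not_assigns h.2]
      simpa [State.setV, h.1] using h'
    simpa [run, State.setV, h.1] using this
  | .seq P Q, h, s => by
    simp only [Prog.assigns, Bool.or_eq_false_iff] at h
    rw [run, run_v_of_not_assigns h.2, run_v_of_not_assigns h.1]

/-! ### Compilation to a while program on stacks -/

/-- The stacks that are used to execute a program: the arrays, in row-major order; for each
variable `x`, stacks of heights `x` and `N - x`; a stack of height `N + 1`, the length of a row; two
auxiliary counters, and a stack for the part of an array that precedes the current element. -/
inductive Key (R V : Type) : Type
  | arr : R → Key R V
  | lo : V → Key R V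
  | hi : V → Key R V
  | stride : Key R V
  | aux : Key R V
  | aux' : Key R V
  | buf : Key R V
  deriving DecidableEq, Fintype

open Key

/-- Move as many symbols from the first stack to the second as precede the element with indices
`x`, `y` in an array. -/
def walk (x y : V) (k k' : Key R V) : Com (Key R V) :=
  .seq (.times (lo x) aux (.times stride aux' (.move k k')))
    (.times (lo y) aux (.move k k'))

/-- The while program that executes a program. -/
def compile : Prog R V → Com (Key R V)
  | .skip => .skip
  | .set r x y c =>
    .seq (walk x y (arr r) buf) (.seq (.seq (.pop (arr r)) (.push (arr r) c))
      (walk x y buf (arr r)))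
  | .tst r x y p P Q =>
    .seq (walk x y (arr r) buf) (.ite (arr r) (fun o => p (o.getD Γ'.blank))
      (.seq (walk x y buf (arr r)) (compile P)) (.seq (walk x y buf (arr r)) (compile Q)))
  | .inc x => .ite (hi x) Option.isSome (.move (hi x) (lo x)) .skip
  | .reset x => .loop (lo x) (.move (lo x) (hi x))
  | .forEach x P =>
    .seq (.loop (lo x) (.move (lo x) (hi x))) (.seq
      (.loop (hi x) (.seq (compile P) (.move (hi x) (lo x))))
      (.loop (lo x) (.move (lo x) (hi x))))
  | .seq P Q => .seq (compile P) (compile Q)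

/-- A bound for the number of steps of `walk`. -/
def walkCost (N : ℕ) : ℕ := N * (((N + 1) * 5 + 2) + 4) + 2 + (N * 5 + 2)

/-- A bound for the number of steps of a compiled program. -/
def cost (N : ℕ) : Prog R V → ℕ
  | .skip => 1
  | .set _ _ _ _ => walkCost N + (2 + walkCost N)
  | .tst _ _ _ _ P Q => walkCost N + (walkCost N + (cost N P + cost N Q) + 1)
  | .inc _ => 2
  | .reset _ => 2 * N + 1
  | .forEach _ P => 2 * N + 1 + ((N * (cost N P + 2) + 1) + (2 * N + 1))
  | .seq P Q => cost N P + cost N Q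

omit [DecidableEq R] [DecidableEq V] in
-- The nesting depth of the loops is fixed by the program, and each loop multiplies the cost by
-- about `N`. A branch is charged for both alternatives, which avoids a maximum of polynomials.
theorem exists_polynomial_cost (P : Prog R V) :
    ∃ p : Polynomial ℕ, ∀ N, p.eval N = cost N P := by
  obtain ⟨w, hw⟩ : ∃ p : Polynomial ℕ, ∀ N, p.eval N = walkCost N :=
    ⟨.X * (((.X + 1) * 5 + 2) + 4) + 2 + (.X * 5 + 2), fun N => by simp [walkCost]⟩
  induction P with
  | skip => exact ⟨1, fun N => by simp [cost]⟩
  | set => exact ⟨w + (2 + w), fun N => by simp [cost, hw]⟩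
  | tst _ _ _ _ P Q ihP ihQ =>
    obtain ⟨p, hp⟩ := ihP
    obtain ⟨q, hq⟩ := ihQ
    exact ⟨w + (w + (p + q) + 1), fun N => by simp [cost, hw, hp, hq]⟩
  | inc => exact ⟨2, fun N => by simp [cost]⟩
  | reset => exact ⟨2 * .X + 1, fun N => by simp [cost]⟩
  | forEach _ P ih =>
    obtain ⟨p, hp⟩ := ih
    exact ⟨2 * .X + 1 + ((.X * (p + 2) + 1) + (2 * .X + 1)), fun N => by simp [cost, hp]⟩
  | seq P Q ihP ihQ =>
    obtain ⟨p, hp⟩ := ihP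
    obtain ⟨q, hq⟩ := ihQ
    exact ⟨p + q, fun N => by simp [cost, hp, hq]⟩

/-- The stacks represent the arrays and variables. -/
structure Rep (N : ℕ) (s : State R V) (S : Store (Key R V)) : Prop where
  arr : ∀ r i j, i ≤ N → j ≤ N → (S (arr r)).getD (i * (N + 1) + j) Γ'.blank = s.A r i j
  len : ∀ r, (S (Key.arr r)).length ≤ (N + 1) * (N + 1)
  v_le : ∀ x, s.v x ≤ N
  lo : ∀ x, S (lo x) = List.replicate (s.v x) Γ'.blank
  hi : ∀ x, S (hi x) = List.replicate (N - s.v x) Γ'.blank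
  stride : S stride = List.replicate (N + 1) Γ'.blank
  aux : S aux = []
  aux' : S aux' = []
  buf : S buf = []

/-- The number of moves is the row-major index of the element: `a` rows of length `N + 1`, by two
nested counting loops, and then `b` single moves. Hypothesis `h` separates the counters from the
stacks that are moved, so that the commutation needed by `exec_times` holds. -/
theorem exec_walk {N : ℕ} (x y : V) {k k' : Key R V} (hk : k ≠ k')
    (h : ∀ j, j = lo x ∨ j = lo y ∨ j = stride ∨ j = aux ∨ j = aux' → j ≠ k ∧ j ≠ k')
    {a b : ℕ} {S : Store (Key R V)} (ha : a ≤ N) (hb : b ≤ N)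
    (hx : S (lo x) = List.replicate a Γ'.blank) (hy : S (lo y) = List.replicate b Γ'.blank)
    (hs : S stride = List.replicate (N + 1) Γ'.blank) (h1 : S aux = []) (h2 : S aux' = []) :
    Exec (walk x y k k') S ((mv k k')^[a * (N + 1) + b] S) (walkCost N) := by
  obtain ⟨hx1, hx2⟩ := h (lo x) (by simp)
  obtain ⟨hy1, hy2⟩ := h (lo y) (by simp)
  obtain ⟨hs1, hs2⟩ := h stride (by simp)
  obtain ⟨ha1, ha2⟩ := h aux (by simp)
  obtain ⟨hb1, hb2⟩ := h aux' (by simp)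
  have inner : ∀ S : Store (Key R V), S stride = List.replicate (N + 1) Γ'.blank ∧ S aux' = [] →
      Exec (.times stride aux' (.move k k')) S ((mv k k')^[N + 1] S) ((N + 1) * 5 + 2) :=
    fun S hS => StackProgram.exec_times (by simp) (fun _ => True) (fun S _ => .move k k' S)
      (fun _ _ => trivial) (fun _ _ => trivial)
      (StackProgram.commute_mv hk (by simp) hs1.symm hb1.symm hs2.symm hb2.symm)
      (fun S => StackProgram.mv_of_ne S hs1 hs2) (fun S => StackProgram.mv_of_ne S hb1 hb2)
      trivial hS.1 hS.2
  have outer : Exec (.times (lo x) aux (.times stride aux' (.move k k'))) S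
      (((mv k k')^[N + 1])^[a] S) (a * ((N + 1) * 5 + 2 + 4) + 2) :=
    StackProgram.exec_times (by simp)
      (fun S => S stride = List.replicate (N + 1) Γ'.blank ∧ S aux' = []) inner
      (fun S hS => by
        rwa [StackProgram.iterate_mv_of_ne _ _ hs1 hs2, StackProgram.iterate_mv_of_ne _ _ hb1 hb2])
      (fun S hS => by
        rwa [StackProgram.mv_of_ne _ (by simp) (by simp),
          StackProgram.mv_of_ne _ (by simp) (by simp)])
      ((StackProgram.commute_mv hk (by simp) hx1.symm ha1.symm hx2.symm ha2.symm).iterate_left _)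
      (fun S => StackProgram.iterate_mv_of_ne _ _ hx1 hx2)
      (fun S => StackProgram.iterate_mv_of_ne _ _ ha1 ha2) ⟨hs, h2⟩ hx h1
  rw [← iterate_mul] at outer
  have last : Exec (.times (lo y) aux (.move k k')) ((mv k k')^[(N + 1) * a] S)
      ((mv k k')^[b] ((mv k k')^[(N + 1) * a] S)) (b * (1 + 4) + 2) :=
    StackProgram.exec_times (by simp) (fun _ => True) (fun S _ => .move k k' S)
      (fun _ _ => trivial) (fun _ _ => trivial)
      (StackProgram.commute_mv hk (by simp) hy1.symm ha1.symm hy2.symm ha2.symm)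
      (fun S => StackProgram.mv_of_ne S hy1 hy2) (fun S => StackProgram.mv_of_ne S ha1 ha2)
      trivial (by rw [StackProgram.iterate_mv_of_ne _ _ hy1 hy2, hy])
      (by rw [StackProgram.iterate_mv_of_ne _ _ ha1 ha2, h1])
  rw [show a * (N + 1) + b = b + (N + 1) * a by ring, iterate_add_apply]
  refine .mono (.seq outer last) ?_
  unfold walkCost
  gcongr

theorem getD_takeD_append (L l : List Γ') (p q : ℕ) :
    (L.takeD p Γ'.blank ++ l).getD q Γ'.blank =
      if q < p then L.getD q Γ'.blank else l.getD (q - p) Γ'.blank := by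
  induction p generalizing L q with
  | zero => simp
  | succ p ih =>
    cases q with
    | zero => cases L <;> simp
    | succ q =>
      simp only [List.takeD, List.cons_append, List.getD_cons_succ, ih]
      cases L <;> simp

theorem Rep.update_arr {N : ℕ} {s s' : State R V} {S : Store (Key R V)} (h : Rep N s S) (r : R)
    (l : List Γ') (hv : s'.v = s.v) (hA : ∀ r', r' ≠ r → s'.A r' = s.A r')
    (hl : l.length ≤ (N + 1) * (N + 1))
    (hl' : ∀ i j, i ≤ N → j ≤ N → l.getD (i * (N + 1) + j) Γ'.blank = s'.A r i j) :
    Rep N s' (update S (Key.arr r) l) where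
  arr r' i j hi hj := by
    by_cases hr : r' = r
    · subst hr; simpa using hl' i j hi hj
    · rw [update_of_ne (by simpa using hr), h.arr _ _ _ hi hj, hA r' hr]
  len r' := by
    by_cases hr : r' = r
    · subst hr; simpa using hl
    · rw [update_of_ne (by simpa using hr)]; exact h.len r'
  v_le x := hv ▸ h.v_le x
  lo x := by rw [update_of_ne (by simp), hv]; exact h.lo x
  hi x := by rw [update_of_ne (by simp), hv]; exact h.hi x
  stride := by rw [update_of_ne (by simp)]; exact h.stride
  aux := by rw [update_of_ne (by simp)]; exact h.aux
  aux' := by rw [update_of_ne (by simp)]; exact h.aux'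
  buf := by rw [update_of_ne (by simp)]; exact h.buf

omit [DecidableEq R] in
theorem Rep.setV {N : ℕ} {s : State R V} {S S' : Store (Key R V)} (h : Rep N s S) (x : V)
    {n : ℕ} (hn : n ≤ N) (hS : ∀ k, k ≠ Key.lo x → k ≠ Key.hi x → S' k = S k)
    (hlo : S' (Key.lo x) = List.replicate n Γ'.blank)
    (hhi : S' (Key.hi x) = List.replicate (N - n) Γ'.blank) : Rep N (s.setV x n) S' where
  arr r i j hi hj := by rw [hS _ (by simp) (by simp)]; exact h.arr r i j hi hj
  len r := by rw [hS _ (by simp) (by simp)]; exact h.len r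
  v_le y := by
    by_cases hy : y = x
    · subst hy; simpa [State.setV] using hn
    · simpa [State.setV, hy] using h.v_le y
  lo y := by
    by_cases hy : y = x
    · subst hy; simpa [State.setV] using hlo
    · rw [hS _ (by simpa using hy) (by simp)]
      simpa [State.setV, hy] using h.lo y
  hi y := by
    by_cases hy : y = x
    · subst hy; simpa [State.setV] using hhi
    · rw [hS _ (by simp) (by simpa using hy)]
      simpa [State.setV, hy] using h.hi y
  stride := by rw [hS _ (by simp) (by simp)]; exact h.stride
  aux := by rw [hS _ (by simp) (by simp)]; exact h.aux
  aux' := by rw [hS _ (by simp) (by simp)]; exact h.aux'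
  buf := by rw [hS _ (by simp) (by simp)]; exact h.buf

theorem Rep.exec_reset {N : ℕ} {s : State R V} {S : Store (Key R V)} (h : Rep N s S) (x : V) :
    ∃ S', Exec (.loop (Key.lo x) (.move (Key.lo x) (Key.hi x))) S S' (2 * N + 1) ∧
      Rep N (s.setV x 0) S' := by
  have hne : Key.lo (R := R) x ≠ Key.hi x := by simp
  refine ⟨_, .mono (StackProgram.exec_loop_mv hne (n := s.v x) (by simp [h.lo])) ?_,
    h.setV x (Nat.zero_le _) (fun k hk hk' => StackProgram.iterate_mv_of_ne _ _ hk hk') ?_ ?_⟩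
  · have := h.v_le x
    omega
  · rw [StackProgram.iterate_mv_fst hne, h.lo]; simp
  · rw [StackProgram.iterate_mv_snd hne (l := 0) (h.lo x), h.hi, ← List.replicate_add]
    have := h.v_le x
    rw [Nat.add_sub_cancel' this, Nat.sub_zero]

theorem Rep.mv_hi {N : ℕ} {s : State R V} {S : Store (Key R V)} (h : Rep N s S) {x : V}
    (hx : s.v x < N) : Rep N (s.setV x (s.v x + 1)) (mv (Key.hi x) (Key.lo x) S) := by
  have hne : Key.hi (R := R) x ≠ Key.lo x := by simp
  obtain ⟨m, hm⟩ : ∃ m, N - s.v x = m + 1 := ⟨N - s.v x - 1, by omega⟩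
  refine h.setV x hx (fun k hk hk' => StackProgram.mv_of_ne _ hk' hk) ?_ ?_
  · rw [StackProgram.mv_snd hne, h.lo, h.hi, hm]; rfl
  · rw [StackProgram.mv_fst hne, h.hi, hm]
    simp only [List.tail_replicate]
    congr 1
    omega

/-- `Rep` is a simulation relation, preserved by every construct. Array elements beyond the end of a
stack count as blank, so arrays need no initialisation. -/
theorem exists_exec_compile {N : ℕ} {P : Prog R V} (hwf : P.wf) {s : State R V}
    {S : Store (Key R V)} (h : Rep N s S) :
    ∃ S', Exec (compile P) S S' (cost N P) ∧ Rep N (run N P s) S' := by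
  induction P generalizing s S with
  | skip => exact ⟨S, .skip S, h⟩
  | set r x y c =>
    have hne : Key.arr (V := V) r ≠ Key.buf := by simp
    set p := s.v x * (N + 1) + s.v y with hp
    have hp' : p < (N + 1) * (N + 1) := by
      have h1 := h.v_le x
      have h2 := h.v_le y
      nlinarith
    set S₁ := (mv (Key.arr r) Key.buf)^[p] S with hS₁
    have h1 : Exec (walk x y (Key.arr r) Key.buf) S S₁ (walkCost N) :=
      exec_walk x y hne (by rintro j (rfl | rfl | rfl | rfl | rfl) <;> simp)
        (h.v_le x) (h.v_le y) (h.lo x) (h.lo y) h.stride h.aux h.aux'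
    have h2 : Exec (.seq (.pop (Key.arr r)) (.push (Key.arr r) c)) S₁
        (update S₁ (Key.arr r) (c :: (S₁ (Key.arr r)).tail)) 2 := by
      have := Exec.seq (.pop (Key.arr r) S₁) (.push (Key.arr r) c _)
      simpa only [update_idem, update_self] using this
    have key : ∀ k : Key R V, k ≠ Key.arr r → k ≠ Key.buf →
        update S₁ (Key.arr r) (c :: (S₁ (Key.arr r)).tail) k = S k := fun k hk hk' => by
      rw [update_of_ne hk, hS₁, StackProgram.iterate_mv_of_ne _ _ hk hk']
    have h3 := exec_walk (N := N) x y hne.symm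
      (S := update S₁ (Key.arr r) (c :: (S₁ (Key.arr r)).tail))
      (by rintro j (rfl | rfl | rfl | rfl | rfl) <;> simp)
      (h.v_le x) (h.v_le y) (by rw [key _ (by simp) (by simp), h.lo])
      (by rw [key _ (by simp) (by simp), h.lo]) (by rw [key _ (by simp) (by simp), h.stride])
      (by rw [key _ (by simp) (by simp), h.aux]) (by rw [key _ (by simp) (by simp), h.aux'])
    rw [← hp, hS₁, StackProgram.iterate_mv_update hne] at h3
    refine ⟨_, .seq h1 (.seq h2 h3), h.update_arr r _ rfl (fun r' hr => ?_) ?_ ?_⟩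
    · funext i j
      simp [run, State.setA, hr]
    · rw [StackProgram.iterate_mv_fst hne]
      have := h.len r
      simp
      omega
    · intro i j hi hj
      rw [StackProgram.iterate_mv_fst hne, getD_takeD_append]
      -- Row-major indices are distinct for distinct elements because columns are below `N + 1`.
      have hinj : i * (N + 1) + j = p ↔ i = s.v x ∧ j = s.v y := by
        rw [hp]
        have h2 := h.v_le y
        constructor
        · intro h0
          have h1 : i = s.v x := by
            have e1 : (i * (N + 1) + j) / (N + 1) = i := by
              rw [mul_comm, Nat.mul_add_div (by omega), Nat.div_eq_of_lt (by omega), add_zero]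
            have e2 : (s.v x * (N + 1) + s.v y) / (N + 1) = s.v x := by
              rw [mul_comm, Nat.mul_add_div (by omega), Nat.div_eq_of_lt (by omega), add_zero]
            rw [← e1, h0, e2]
          subst h1
          exact ⟨rfl, by omega⟩
        · rintro ⟨rfl, rfl⟩; rfl
      simp only [run, State.setA, true_and]
      by_cases hij : i = s.v x ∧ j = s.v y
      · rw [if_pos hij, hinj.2 hij]
        simp
      · rw [if_neg hij, ← h.arr r i j hi hj]
        have := mt hinj.1 hij
        split_ifs with hlt
        · rfl
        · obtain ⟨m, hm⟩ : ∃ m, i * (N + 1) + j - p = m + 1 :=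
            ⟨i * (N + 1) + j - p - 1, by omega⟩
          rw [hm, List.getD_cons_succ]
          simp only [List.getD_eq_getElem?_getD, List.tail_drop, List.getElem?_drop]
          congr 2
          omega
  | tst r x y p P Q ihP ihQ =>
    simp only [Prog.wf, Bool.and_eq_true] at hwf
    have hne : Key.arr (V := V) r ≠ Key.buf := by simp
    set q := s.v x * (N + 1) + s.v y with hq
    set S₁ := (mv (Key.arr r) Key.buf)^[q] S with hS₁
    have hq' : q < (N + 1) * (N + 1) := by
      have h1 := h.v_le x
      have h2 := h.v_le y
      nlinarith
    have h1 : Exec (walk x y (Key.arr r) Key.buf) S S₁ (walkCost N) :=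
      exec_walk x y hne (by rintro j (rfl | rfl | rfl | rfl | rfl) <;> simp)
        (h.v_le x) (h.v_le y) (h.lo x) (h.lo y) h.stride h.aux h.aux'
    have key : ∀ k : Key R V, k ≠ Key.arr r → k ≠ Key.buf → S₁ k = S k := fun k hk hk' =>
      StackProgram.iterate_mv_of_ne _ _ hk hk'
    have h3 := exec_walk (N := N) x y hne.symm (S := S₁)
      (by rintro j (rfl | rfl | rfl | rfl | rfl) <;> simp)
      (h.v_le x) (h.v_le y) (by rw [key _ (by simp) (by simp), h.lo])
      (by rw [key _ (by simp) (by simp), h.lo]) (by rw [key _ (by simp) (by simp), h.stride])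
      (by rw [key _ (by simp) (by simp), h.aux]) (by rw [key _ (by simp) (by simp), h.aux'])
    have h4 := StackProgram.iterate_mv_update hne q S (S₁ (Key.arr r))
    rw [← hS₁, update_eq_self] at h4
    rw [← hq, h4, hS₁, StackProgram.iterate_mv_fst hne, ← hS₁] at h3
    -- Reading an element may pad the stack with blanks, but this changes no element of the array.
    have hrep : Rep N s (update S (Key.arr r)
        ((S (Key.arr r)).takeD q Γ'.blank ++ (S (Key.arr r)).drop q)) := by
      refine h.update_arr r _ rfl (fun _ _ => rfl) ?_ ?_
      · have := h.len r
        simp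
        omega
      · intro i j hi hj
        rw [getD_takeD_append, ← h.arr r i j hi hj]
        split_ifs with hlt
        · rfl
        · simp only [List.getD_eq_getElem?_getD, List.getElem?_drop]
          congr 2
          omega
    have htop : (S₁ (Key.arr r)).head?.getD Γ'.blank = s.A r (s.v x) (s.v y) := by
      rw [← h.arr r _ _ (h.v_le x) (h.v_le y), hS₁, StackProgram.iterate_mv_fst hne,
        List.head?_drop, List.getD_eq_getElem?_getD]
    simp only [run]
    cases hpv : p (s.A r (s.v x) (s.v y)) with
    | true =>
      obtain ⟨S', hS', hR⟩ := ihP hwf.1 hrep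
      exact ⟨S', .seq h1 (.iteTrue (by simpa [htop] using hpv)
        (.mono (.seq h3 hS') (by omega))), by simpa using hR⟩
    | false =>
      obtain ⟨S', hS', hR⟩ := ihQ hwf.2 hrep
      exact ⟨S', .seq h1 (.iteFalse (by simpa [htop] using hpv)
        (.mono (.seq h3 hS') (by omega))), by simpa using hR⟩
  | inc x =>
    by_cases hx : s.v x < N
    · refine ⟨_, .iteTrue ?_ (.move _ _ S), ?_⟩
      · obtain ⟨m, hm⟩ : ∃ m, N - s.v x = m + 1 := ⟨N - s.v x - 1, by omega⟩
        rw [h.hi, hm]; rfl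
      · rw [run, min_eq_left (by omega)]
        exact h.mv_hi hx
    · have hxN : s.v x = N := le_antisymm (h.v_le x) (by omega)
      refine ⟨S, .iteFalse (by rw [h.hi, hxN]; simp) (.skip S), ?_⟩
      rw [run, min_eq_right (by omega)]
      exact h.setV x le_rfl (fun _ _ _ => rfl) (by rw [h.lo, hxN]) (by rw [h.hi, hxN])
  | reset x => exact h.exec_reset x
  | forEach x P ih =>
    simp only [Prog.wf, Bool.and_eq_true, Bool.not_eq_true'] at hwf
    obtain ⟨S₀, hS₀, hR₀⟩ := h.exec_reset x
    -- The loop variable is its own counter: `hi x` has height `N - i`, the number `m` of iterations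
    -- left. The invariant represents the state in which `x` is already set to `i`.
    have body : ∀ m i S, i + m = N →
        Rep N ((iter (fun i s => run N P (s.setV x i)) i s).setV x i) S →
        ∃ S', Exec (.loop (Key.hi x) (.seq (compile P) (.move (Key.hi x) (Key.lo x)))) S S'
            (m * (cost N P + 2) + 1) ∧
          Rep N ((iter (fun i s => run N P (s.setV x i)) N s).setV x N) S' := by
      intro m
      induction m with
      | zero =>
        intro i S hi hR
        obtain rfl : i = N := by omega
        refine ⟨S, .mono (.loopNil ?_) (by omega), hR⟩
        simp [hR.hi, State.setV]
      | succ m ihm =>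
        intro i S hi hR
        obtain ⟨S₁, hS₁, hR₁⟩ := ih hwf.2 hR
        -- Well-formedness enters here: the body leaves `x` alone, so that the move after it turns
        -- `i` into `i + 1`.
        have hv : (run N P ((iter (fun i s => run N P (s.setV x i)) i s).setV x i)).v x = i := by
          rw [run_v_of_not_assigns hwf.1]; simp [State.setV]
        have hR₂ := hR₁.mv_hi (x := x) (by omega)
        rw [hv] at hR₂
        obtain ⟨S₂, hS₂, hR₃⟩ := ihm (i + 1) _ (by omega) hR₂
        refine ⟨S₂, .mono (.loopCons ?_ (.seq hS₁ (.move _ _ _)) hS₂) (by ring_nf; omega), hR₃⟩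
        have : N - i = m + 1 := by omega
        simp [hR.hi, State.setV, this]
    obtain ⟨S₁, hS₁, hR₁⟩ := body N 0 S₀ (by omega) hR₀
    obtain ⟨S₂, hS₂, hR₂⟩ := hR₁.exec_reset x
    refine ⟨S₂, .seq hS₀ (.seq hS₁ hS₂), ?_⟩
    simpa [State.setV, run] using hR₂
  | seq P Q ihP ihQ =>
    simp only [Prog.wf, Bool.and_eq_true] at hwf
    obtain ⟨S₁, hS₁, hR₁⟩ := ihP hwf.1 h
    obtain ⟨S₂, hS₂, hR₂⟩ := ihQ hwf.2 hR₁
    exact ⟨S₂, .seq hS₁ hS₂, hR₂⟩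

end ArrayProgram

end

/-! ### Initialisation, clean-up and the polynomial-time criterion -/

section

open Computability Function

namespace ArrayProgram

open StackProgram (Com Store Exec mv single)

variable {R V : Type} [DecidableEq R] [DecidableEq V]

/-- The arrays and variables at the start: a word is the beginning of one of the arrays. -/
def initial (V : Type) (inp : R) (w : List Γ') : State R V :=
  ⟨fun r i j => if r = inp then w.getD (i * (w.length + 1) + j) Γ'.blank else Γ'.blank, fun _ => 0⟩

/-- The counters that depend on the length of the input. -/
noncomputable def counters (R V : Type) [Fintype V] : List (Key R V) :=
  Key.stride :: (Finset.univ : Finset V).toList.map Key.hi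

/-- Set up the counters, given an input word on the stack of the array `inp`. -/
noncomputable def setup [Fintype V] (inp : R) : Com (Key R V) :=
  .seq (.loop (Key.arr inp) (.seq (.tick (counters R V)) (.move (Key.arr inp) Key.buf)))
    (.seq (.push Key.stride Γ'.blank) (.loop Key.buf (.move Key.buf (Key.arr inp))))

omit [DecidableEq R] [DecidableEq V] in
theorem nodup_counters [Fintype V] : (counters R V).Nodup := by
  rw [counters, List.nodup_cons]
  exact ⟨by simp, (Finset.nodup_toList _).map fun a b h => by simpa using h⟩

/-- One pass over the input raises all counters simultaneously while the input goes to the buffer.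
-/
theorem exec_count [Fintype V] (inp : R) (n : ℕ) (S : Store (Key R V))
    (hS : (S (Key.arr inp)).length = n) :
    Exec (.loop (Key.arr inp) (.seq (.tick (counters R V)) (.move (Key.arr inp) Key.buf))) S
      (fun k => if k ∈ counters R V then List.replicate n Γ'.blank ++ S k else
        (mv (Key.arr inp) Key.buf)^[n] S k) (n * ((counters R V).length + 3) + 1) := by
  have hne : Key.arr (V := V) inp ≠ Key.buf := by simp
  have ha : Key.arr inp ∉ counters R V := by simp [counters]
  have hb : Key.buf ∉ counters R V := by simp [counters]
  induction n generalizing S with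
  | zero => simpa using .loopNil (List.length_eq_zero_iff.1 hS)
  | succ n ih =>
    set S₁ : Store (Key R V) := fun k => if k ∈ counters R V then Γ'.blank :: S k else S k with hS₁
    have h1 := StackProgram.exec_tick (counters R V) nodup_counters S
    rw [← hS₁] at h1
    have h2 := ih (mv (Key.arr inp) Key.buf S₁) (by
      rw [StackProgram.mv_fst hne]; simp [hS₁, ha, hS])
    -- The moves ignore the counters, so stores that agree off the counters continue to do so.
    have h3 : ∀ (m : ℕ) (T T' : Store (Key R V)),
        (∀ k, k ∉ counters R V → T k = T' k) → ∀ k, k ∉ counters R V →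
        (mv (Key.arr inp) Key.buf)^[m] T k = (mv (Key.arr inp) Key.buf)^[m] T' k := by
      intro m
      induction m with
      | zero => exact fun T T' h => h
      | succ m ihm =>
        intro T T' h
        refine ihm _ _ fun k hk => ?_
        rw [StackProgram.mv_apply _ _ _ _ hne, StackProgram.mv_apply _ _ _ _ hne, h _ hk, h _ ha,
          h _ hb]
    refine .mono (.loopCons (by rintro h; simp [h] at hS) (.seq h1 (.move _ _ _))
      (h2.congr_right ?_)) (le_of_eq (by ring))
    funext k
    by_cases hk : k ∈ counters R V
    · rw [if_pos hk, if_pos hk, StackProgram.mv_of_ne _ (by rintro rfl; exact ha hk)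
        (by rintro rfl; exact hb hk), hS₁]
      simp only [if_pos hk, List.replicate_succ']
      simp
    · rw [if_neg hk, if_neg hk, iterate_succ_apply]
      refine h3 n _ _ (fun k hk => ?_) k hk
      simp [StackProgram.mv_apply _ _ _ _ hne, hS₁, hk, ha, hb]

/-- The input word, as it stands, is the stack of the array `inp`, and an empty stack is a blank
array or a zero. Hence only `stride` and the stacks `hi x` have to be filled; the one additional
blank makes `stride` as high as a row is long. -/
theorem exec_setup [Fintype V] (inp : R) (w : List Γ') :
    ∃ S, Exec (setup inp) (single (Key.arr inp) w) S
        (w.length * ((counters R V).length + 5) + 3) ∧ Rep w.length (initial V inp w) S := by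
  have hne : Key.arr (V := V) inp ≠ Key.buf := by simp
  have ha : Key.arr inp ∉ counters R V := by simp [counters]
  have hb : Key.buf ∉ counters R V := by simp [counters]
  have hs : Key.stride ∈ counters R V := by simp [counters]
  have h1 := exec_count (V := V) inp w.length (single (Key.arr inp) w) (by simp [single])
  set S₁ : Store (Key R V) := fun k => if k ∈ counters R V then
    List.replicate w.length Γ'.blank ++ single (Key.arr inp) w k else
      (mv (Key.arr inp) Key.buf)^[w.length] (single (Key.arr inp) w) k with hS₁
  set S₂ := update S₁ Key.stride (Γ'.blank :: S₁ Key.stride) with hS₂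
  have hbuf : ∀ n (T : Store (Key R V)), ((mv (Key.arr inp) Key.buf)^[n] T Key.buf).length =
      (T Key.buf).length + n := by
    intro n
    induction n with
    | zero => simp
    | succ n ih =>
      intro T
      rw [iterate_succ_apply, ih, StackProgram.mv_snd hne]
      simp only [List.length_cons]
      ring
  have h3 := StackProgram.exec_loop_mv hne.symm (n := w.length) (S := S₂) (by
    rw [hS₂, update_of_ne (by simp), hS₁]
    simp only [if_neg hb]
    rw [hbuf]
    simp [single])
  refine ⟨_, .mono (.seq h1 (.seq (.push _ _ _) h3)) (by ring_nf; omega), ?_⟩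
  have hmem : ∀ k, k ∈ counters R V → k ≠ Key.stride →
      (mv Key.buf (Key.arr inp))^[w.length] S₂ k = List.replicate w.length Γ'.blank := by
    intro k hk hk'
    have h1 : k ≠ Key.arr inp := by rintro rfl; exact ha hk
    rw [StackProgram.iterate_mv_of_ne _ _ (by rintro rfl; exact hb hk) h1,
      hS₂, update_of_ne hk', hS₁]
    simp [hk, single, h1]
  have hmv : ∀ (m : ℕ) (T T' : Store (Key R V)),
      (∀ k, k ∉ counters R V → T k = T' k) → ∀ k, k ∉ counters R V →
      (mv Key.buf (Key.arr inp))^[m] T k = (mv Key.buf (Key.arr inp))^[m] T' k := by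
    intro m
    induction m with
    | zero => exact fun T T' h => h
    | succ m ihm =>
      intro T T' h
      refine ihm _ _ fun k hk => ?_
      rw [StackProgram.mv_apply _ _ _ _ hne.symm, StackProgram.mv_apply _ _ _ _ hne.symm, h _ hk,
        h _ ha, h _ hb]
  have hnot : ∀ k, k ∉ counters R V →
      (mv Key.buf (Key.arr inp))^[w.length] S₂ k = single (Key.arr inp) w k := by
    intro k hk
    rw [hmv w.length S₂ ((mv (Key.arr inp) Key.buf)^[w.length] (single (Key.arr inp) w)) _ k hk,
      StackProgram.iterate_mv_mv hne (by simp [single])]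
    intro k hk
    rw [hS₂, update_of_ne (by rintro rfl; exact hk hs), hS₁]
    simp [hk]
  constructor
  · intro r i j _ _
    rw [hnot _ (by simp [counters]), single, initial]
    by_cases hr : r = inp
    · subst hr; simp
    · simp [hr]
  · intro r
    rw [hnot _ (by simp [counters]), single]
    by_cases hr : r = inp
    · subst hr
      simp only [update_self]
      nlinarith
    · simp [hr]
  · intro x
    exact Nat.zero_le _
  · intro x
    rw [hnot _ (by simp [counters])]
    simp [single, initial]
  · intro x
    rw [hmem _ (by simp [counters]) (by simp)]
    simp [initial]
  · rw [StackProgram.iterate_mv_of_ne _ _ (by simp) (by simp), hS₂, update_self, hS₁]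
    simp [hs, single, List.replicate_succ]
  all_goals
    rw [hnot _ (by simp [counters])]
    simp [single]

/-- Empty all stacks, except that the first element of an array decides whether a symbol is left on
the stack of this array. -/
noncomputable def teardown [Fintype R] [Fintype V] (out : R) (p : Γ' → Bool) : Com (Key R V) :=
  .ite (Key.arr out) (fun o => p (o.getD Γ'.blank))
    (.seq (.clear Finset.univ.toList) (.push (Key.arr out) Γ'.blank))
    (.clear Finset.univ.toList)

/-- The machine has to halt with empty stacks. Each stack has height at most `(N + 1) * (N + 1)`, by
`Rep`, so clearing all of them is cheap. -/
theorem exec_teardown [Fintype R] [Fintype V] (out : R) (p : Γ' → Bool) {N : ℕ} {s : State R V}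
    {S : Store (Key R V)} (h : Rep N s S) :
    Exec (teardown out p) S
      (single (Key.arr out) (if p (s.A out 0 0) then [Γ'.blank] else []))
      (Fintype.card (Key R V) * (2 * ((N + 1) * (N + 1)) + 1) + 3) := by
  have hlen : ∀ k, (S k).length ≤ (N + 1) * (N + 1) := by
    have h1 : N + 1 ≤ (N + 1) * (N + 1) := Nat.le_mul_of_pos_left _ (by omega)
    intro k
    cases k with
    | arr r => exact h.len r
    | lo x => rw [h.lo, List.length_replicate]; have := h.v_le x; omega
    | hi x => rw [h.hi, List.length_replicate]; omega
    | stride => rw [h.stride, List.length_replicate]; exact h1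
    | aux => simp [h.aux]
    | aux' => simp [h.aux']
    | buf => simp [h.buf]
  have hc := StackProgram.exec_clear (Finset.univ : Finset (Key R V)).toList hlen
  simp only [Finset.mem_toList, Finset.mem_univ, if_true, Finset.length_toList,
    Finset.card_univ] at hc
  have h0 : (S (Key.arr out)).head?.getD Γ'.blank = s.A out 0 0 := by
    rw [← h.arr out 0 0 (Nat.zero_le _) (Nat.zero_le _)]
    cases S (Key.arr out) <;> simp
  cases hp : p (s.A out 0 0) with
  | true =>
    exact .mono (.iteTrue (by rw [h0, hp]) (.seq hc (.push _ _ _))) (by omega)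
  | false =>
    refine .mono (.iteFalse (by rw [h0, hp]) (t := _) ?_) (Nat.le_succ _)
    have : single (Key.arr out) (if false = true then [Γ'.blank] else []) =
        (fun _ => [] : Store (Key R V)) := by
      funext k
      by_cases hk : k = Key.arr out
      · subst hk; simp [single]
      · simp [single, hk]
    rw [this]
    exact .mono hc (by omega)

/-- A decision problem is polynomial-time computable if an array program decides it. -/
theorem nonempty_computableInPolyTime [Fintype R] [Fintype V] {α : Type} (enc : α → List Γ')
    (f : α → Bool) (P : Prog R V) (hP : P.wf) (inp out : R) (p : Γ' → Bool)
    (h : ∀ a, p ((run (enc a).length P (initial V inp (enc a))).A out 0 0) = f a) :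
    Nonempty (Turing.TM2ComputableInPolyTime enc encodeBool f) := by
  obtain ⟨c, hc⟩ := exists_polynomial_cost P
  refine StackProgram.nonempty_computableInPolyTime enc f
    (.seq (setup inp) (.seq (compile P) (teardown out p))) (Key.arr inp) (Key.arr out)
    ((.X * ((counters R V).length + 5 : ℕ) + 3) + (c +
      (Fintype.card (Key R V) * (2 * ((.X + 1) * (.X + 1)) + 1) + 3))) fun a => ?_
  obtain ⟨S₁, hS₁, hR₁⟩ := exec_setup (V := V) inp (enc a)
  obtain ⟨S₂, hS₂, hR₂⟩ := exists_exec_compile hP hR₁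
  have h3 := exec_teardown out p hR₂
  rw [h a] at h3
  refine .mono (.seq hS₁ (.seq hS₂ h3)) (le_of_eq ?_)
  simp [hc]

end ArrayProgram

end

/-! ### Bipartite matching by auction -/

/-- There is a matching with edges in `E` that covers the numbers below `n`. -/
def HasMatching (n : ℕ) (E : ℕ → ℕ → Prop) : Prop :=
  ∃ φ : ℕ → ℕ, (∀ a < n, E a (φ a)) ∧ ∀ a < n, ∀ b < n, φ a = φ b → a = b

/-- A state of the auction for a bipartite graph with edges `E` between agents below `n` and houses
below `m`: `O a h` if the agent `a` owns the house `h`, `P h j` if the price of `h` is larger than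
`j`, and `F a` if `a` owns a house. -/
structure Auction (n m N : ℕ) (E O P : ℕ → ℕ → Prop) (F : ℕ → Prop) : Prop where
  edge_lt : ∀ {a h}, E a h → a < n ∧ h < m
  own_edge : ∀ {a h}, O a h → E a h
  own_left : ∀ {a b h}, O a h → O b h → a = b
  own_right : ∀ {a h h'}, O a h → O a h' → h = h'
  assigned : ∀ a, F a ↔ ∃ h, O a h
  price_lt : ∀ {h j}, P h j → h < m ∧ j < N
  price_anti : ∀ {h j}, P h (j + 1) → P h j
  price_own : ∀ {h}, P h 0 → ∃ a, O a h
  slack : ∀ {a h h' j}, O a h → E a h' → P h (j + 1) → P h' j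

/-- The sum of the prices. -/
noncomputable def totalPrice (P : ℕ → ℕ → Prop) : ℕ := {x : ℕ × ℕ | P x.1 x.2}.ncard

namespace Auction

variable {n m N : ℕ} {E O P : ℕ → ℕ → Prop} {F : ℕ → Prop}

theorem price_mono (hA : Auction n m N E O P F) {h i j : ℕ} (hij : i ≤ j) (hP : P h j) :
    P h i := by
  induction j, hij using Nat.le_induction with
  | base => exact hP
  | succ j _ ih => exact ih (hA.price_anti hP)

theorem finite_price (hA : Auction n m N E O P F) : {x : ℕ × ℕ | P x.1 x.2}.Finite :=
  (Finset.finite_toSet (Finset.range m ×ˢ Finset.range N)).subset fun x hx => by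
    simpa using hA.price_lt hx

theorem totalPrice_le (hA : Auction n m N E O P F) : totalPrice P ≤ m * N := by
  have h : {x : ℕ × ℕ | P x.1 x.2} ⊆ (Finset.range m ×ˢ Finset.range N : Finset (ℕ × ℕ)) :=
    fun x hx => by simpa using hA.price_lt hx
  have := Set.ncard_le_ncard h (Finset.finite_toSet _)
  rwa [Set.ncard_coe_finset, Finset.card_product, Finset.card_range, Finset.card_range] at this

/-- The agent `a` without a house takes the cheapest house that it accepts. -/
theorem take (hA : Auction n m N E O P F) {a h j : ℕ} (hF : ¬F a) (hE : E a h) (hj : j < N)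
    (hmin : ∀ h' i, i < j → E a h' → P h' i) (hP : ¬P h j) {O' P' : ℕ → ℕ → Prop} {F' : ℕ → Prop}
    (hO' : ∀ b k, O' b k ↔ if k = h then b = a else O b k)
    (hP' : ∀ k i, P' k i ↔ P k i ∨ k = h ∧ i = j)
    (hF' : ∀ b, F' b ↔ b = a ∨ F b ∧ ¬O b h) :
    Auction n m N E O' P' F' := by
  -- Together with `hmin` this says that the price of `h` is exactly `j`.
  have hlt : ∀ {i}, P h i → i < j := fun {i} hi => by
    by_contra hij
    exact hP (hA.price_mono (not_lt.1 hij) hi)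
  have hO : ∀ k, ¬O a k := fun k hk => hF ((hA.assigned a).2 ⟨k, hk⟩)
  refine ⟨hA.edge_lt, ?_, ?_, ?_, ?_, ?_, ?_, ?_, ?_⟩
  · intro b k hb
    rw [hO'] at hb
    split_ifs at hb with hk
    · exact hb ▸ hk ▸ hE
    · exact hA.own_edge hb
  · intro b c k hb hc
    rw [hO'] at hb hc
    split_ifs at hb hc with hk
    · rw [hb, hc]
    · exact hA.own_left hb hc
  · intro b k k' hb hc
    rw [hO'] at hb hc
    split_ifs at hb hc with hk hk' hk'
    · rw [hk, hk']
    · exact absurd (hb ▸ hc) (hO _)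
    · exact absurd (hc ▸ hb) (hO _)
    · exact hA.own_right hb hc
  · intro b
    rw [hF']
    constructor
    · rintro (rfl | ⟨hb, hbh⟩)
      · exact ⟨h, by simp [hO']⟩
      · obtain ⟨k, hk⟩ := (hA.assigned b).1 hb
        refine ⟨k, (hO' _ _).2 ?_⟩
        rw [if_neg]
        · exact hk
        · rintro rfl; exact hbh hk
    · rintro ⟨k, hk⟩
      rw [hO'] at hk
      split_ifs at hk with hkh
      · exact .inl hk
      · exact .inr ⟨(hA.assigned b).2 ⟨k, hk⟩, fun hb => hkh (hA.own_right hk hb)⟩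
  · intro k i hk
    rcases (hP' k i).1 hk with hk | ⟨rfl, rfl⟩
    · exact hA.price_lt hk
    · exact ⟨(hA.edge_lt hE).2, hj⟩
  · intro k i hk
    refine (hP' k i).2 (.inl ?_)
    rcases (hP' k (i + 1)).1 hk with hk | ⟨rfl, rfl⟩
    · exact hA.price_anti hk
    · exact hmin k i (by omega) hE
  · intro k hk
    by_cases hkh : k = h
    · exact ⟨a, by simp [hO', hkh]⟩
    · rcases (hP' k 0).1 hk with hk | ⟨rfl, -⟩
      · obtain ⟨b, hb⟩ := hA.price_own hk
        exact ⟨b, by simpa [hO', hkh] using hb⟩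
      · exact absurd rfl hkh
  -- For the new owner `a`, `h` was a cheapest accepted house, so after the increment it exceeds the
  -- others by at most one. For the other owners, the price of their own house is unchanged and no
  -- price falls.
  · intro b k k' i hb hE' hk
    refine (hP' k' i).2 (.inl ?_)
    rw [hO'] at hb
    split_ifs at hb with hkh
    · subst hkh hb
      refine hmin k' i ?_ hE'
      rcases (hP' k (i + 1)).1 hk with hk | ⟨-, rfl⟩
      · exact (Nat.lt_succ_self i).trans (hlt hk)
      · exact Nat.lt_succ_self i
    · rcases (hP' k (i + 1)).1 hk with hk | ⟨rfl, -⟩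
      · exact hA.slack hb hE' hk
      · exact absurd rfl hkh

theorem totalPrice_take (hA : Auction n m N E O P F) {h j : ℕ} (hP : ¬P h j)
    {P' : ℕ → ℕ → Prop} (hP' : ∀ k i, P' k i ↔ P k i ∨ k = h ∧ i = j) :
    totalPrice P' = totalPrice P + 1 := by
  have : {x : ℕ × ℕ | P' x.1 x.2} = insert (h, j) {x : ℕ × ℕ | P x.1 x.2} := by
    ext ⟨k, i⟩
    simp [hP', or_comm]
  rw [totalPrice, this, Set.ncard_insert_of_notMem (by simpa using hP) hA.finite_price, totalPrice]

/-- If all houses that an agent without a house accepts have a price of at least `n`, then no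
matching covers all agents. -/
theorem not_hasMatching (hA : Auction n m N E O P F) (hnN : n ≤ N) {a₀ : ℕ} (ha₀ : a₀ < n)
    (hF : ¬F a₀) (hP : ∀ h j, j < N → E a₀ h → P h j) : ¬HasMatching n E := by
  classical
  rintro ⟨φ, hφE, hφ⟩
  have hown : ∀ h, ∃ b, P h 0 → O b h := fun h => by
    by_cases h0 : P h 0
    · obtain ⟨b, hb⟩ := hA.price_own h0
      exact ⟨b, fun _ => hb⟩
    · exact ⟨0, fun h1 => absurd h1 h0⟩
  choose ow how using hown
  have hO : ∀ {h j}, P h j → O (ow h) h := fun h1 => how _ (hA.price_mono (Nat.zero_le _) h1)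
  have hne : ∀ {h j}, P h j → ow h ≠ a₀ := fun h1 h2 =>
    hF ((hA.assigned _).2 ⟨_, h2 ▸ hO h1⟩)
  have hlt : ∀ {h j}, P h j → ow h < n := fun h1 => (hA.edge_lt (hA.own_edge (hO h1))).1
  -- The houses of price larger than `j`.
  let T : ℕ → Finset ℕ := fun j => (Finset.range m).filter fun h => P h j
  have hT : ∀ {h j}, h ∈ T j ↔ P h j := fun {h j} => by
    simpa [T] using fun h1 => (hA.price_lt h1).1
  -- The supposed matching `φ` sends the owners of `T (j + 1)` into `T j`, by `slack`, and also
  -- `a₀`, by `hP`. The owners are distinct and different from `a₀`.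
  have step : ∀ j, j < N → (T (j + 1)).card + 1 ≤ (T j).card := by
    intro j hj
    have hnot : φ a₀ ∉ (T (j + 1)).image fun h => φ (ow h) := by
      intro h1
      obtain ⟨h, hh, heq⟩ := Finset.mem_image.1 h1
      exact hne (hT.1 hh) (hφ _ (hlt (hT.1 hh)) _ ha₀ heq)
    have hinj : Set.InjOn (fun h => φ (ow h)) (T (j + 1)) := by
      intro h hh h' hh' heq
      have h1 := hT.1 (Finset.mem_coe.1 hh)
      have h2 := hT.1 (Finset.mem_coe.1 hh')
      have h3 : ow h = ow h' := hφ _ (hlt h1) _ (hlt h2) heq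
      exact hA.own_right (hO h1) (h3 ▸ hO h2)
    rw [← Finset.card_image_of_injOn hinj, ← Finset.card_insert_of_notMem hnot]
    refine Finset.card_le_card fun h hh => hT.2 ?_
    rcases Finset.mem_insert.1 hh with rfl | hh
    · exact hP _ _ hj (hφE _ ha₀)
    · obtain ⟨k, hk, rfl⟩ := Finset.mem_image.1 hh
      exact hA.slack (hO (hT.1 hk)) (hφE _ (hlt (hT.1 hk))) (hT.1 hk)
  -- Descending from level `N`, where nothing is claimed, each level contributes one house.
  have count : ∀ i ≤ N, i ≤ (T (N - i)).card := by
    intro i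
    induction i with
    | zero => simp
    | succ i ih =>
      intro hi
      have h1 := ih (by omega)
      have h2 := step (N - (i + 1)) (by omega)
      rw [show N - (i + 1) + 1 = N - i by omega] at h2
      omega
  have h0 := count N le_rfl
  rw [Nat.sub_self] at h0
  -- The owners of `T 0` and `a₀` are more than `N ≥ n` distinct agents, a contradiction.
  have hnot : a₀ ∉ (T 0).image ow := by
    intro h1
    obtain ⟨h, hh, heq⟩ := Finset.mem_image.1 h1
    exact hne (hT.1 hh) heq
  have hinj : Set.InjOn ow (T 0) := by
    intro h hh h' hh' heq
    have h1 := hT.1 (Finset.mem_coe.1 hh)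
    have h2 := hT.1 (Finset.mem_coe.1 hh')
    exact hA.own_right (hO h1) (heq ▸ hO h2)
  have h1 : (insert a₀ ((T 0).image ow)).card ≤ n := by
    rw [← Finset.card_range n]
    refine Finset.card_le_card fun b hb => Finset.mem_range.2 ?_
    rcases Finset.mem_insert.1 hb with rfl | hb
    · exact ha₀
    · obtain ⟨k, hk, rfl⟩ := Finset.mem_image.1 hb
      exact hlt (hT.1 hk)
  rw [Finset.card_insert_of_notMem hnot, Finset.card_image_of_injOn hinj] at h1
  omega

theorem hasMatching (hA : Auction n m N E O P F) (hF : ∀ a < n, F a) : HasMatching n E := by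
  have : ∀ a, ∃ h, a < n → O a h := fun a => by
    by_cases ha : a < n
    · obtain ⟨h, hh⟩ := (hA.assigned a).1 (hF a ha)
      exact ⟨h, fun _ => hh⟩
    · exact ⟨0, fun h => absurd h ha⟩
  choose φ hφ using this
  exact ⟨φ, fun a ha => hA.own_edge (hφ a ha), fun a ha b hb h =>
    hA.own_left (hφ a ha) (h ▸ hφ b hb)⟩

end Auction

/-! ### The auction as an array program -/

section

open Computability Function

namespace ArrayProgram

variable {R V : Type} [DecidableEq R] [DecidableEq V]

/-- Rule for loops: a property of the arrays that the loop body propagates. -/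
theorem run_forEach_induction {N : ℕ} {x : V} {P : Prog R V} {s : State R V}
    (p : ℕ → (R → ℕ → ℕ → Γ') → Prop) (h0 : p 0 s.A)
    (hs : ∀ i s', i < N → (∀ r, P.writes r = false → s'.A r = s.A r) →
      (∀ y, y ≠ x → P.assigns y = false → s'.v y = s.v y) → s'.v x = i → p i s'.A →
      p (i + 1) (run N P s').A) :
    p N (run N (.forEach x P) s).A := by
  suffices h : p N (iter (fun i s => run N P (s.setV x i)) N s).A ∧
      (∀ r, P.writes r = false → (iter (fun i s => run N P (s.setV x i)) N s).A r = s.A r) ∧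
      (∀ y, y ≠ x → P.assigns y = false →
        (iter (fun i s => run N P (s.setV x i)) N s).v y = s.v y) from h.1
  refine iter_induction (fun i (s' : State R V) => p i s'.A ∧ (∀ r, P.writes r = false → s'.A r = s.A r) ∧
    (∀ y, y ≠ x → P.assigns y = false → s'.v y = s.v y))
    ⟨h0, fun _ _ => rfl, fun _ _ _ => rfl⟩ ?_
  rintro i s' hi ⟨hp, hA, hv⟩
  have hv' : ∀ y, y ≠ x → P.assigns y = false → (s'.setV x i).v y = s.v y := fun y hy hy' => by
    simpa [State.setV, hy] using hv y hy hy'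
  refine ⟨hs i (s'.setV x i) hi hA hv' (by simp [State.setV]) hp, fun r hr => ?_,
    fun y hy hy' => ?_⟩
  · rw [run_A_of_not_writes hr]; exact hA r hr
  · rw [run_v_of_not_assigns hy']; exact hv' y hy hy'

/-- The symbol that marks an array element. -/
abbrev mark : Γ' := Γ'.bit true

/-- An array element is marked. -/
abbrev On (A : R → ℕ → ℕ → Γ') (r : R) (i j : ℕ) : Prop := A r i j = mark

/-- Execute a program if an array element is marked. -/
abbrev Prog.when (r : R) (x y : V) (P : Prog R V) : Prog R V := .tst r x y (· = mark) P .skip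

/-- Execute a program if an array element is not marked. -/
abbrev Prog.whenNot (r : R) (x y : V) (P : Prog R V) : Prog R V := .tst r x y (· = mark) .skip P

theorem run_when (N : ℕ) (r : R) (x y : V) (P : Prog R V) (s : State R V) :
    run N (.when r x y P) s = if On s.A r (s.v x) (s.v y) then run N P s else s := by
  simp [run]

theorem run_whenNot (N : ℕ) (r : R) (x y : V) (P : Prog R V) (s : State R V) :
    run N (.whenNot r x y P) s = if On s.A r (s.v x) (s.v y) then s else run N P s := by
  simp [run]

end ArrayProgram

namespace HouseProgram

open ArrayProgram ArrayProgram.Prog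

/-- The arrays of the decision procedure. -/
inductive Arr : Type
  /-- the input -/
  | inp
  /-- the bracketing depth during parsing: blank, `bra` or `comma` -/
  | depth
  /-- `cont c i`: the `i`th symbol of the `c`th utility -/
  | cont
  /-- `row c a`: the `c`th utility belongs to the agent `a` -/
  | row
  /-- `col c h`: the `c`th utility belongs to the house `h` -/
  | col
  /-- `agents 0 a`: there is an agent `a` -/
  | agents
  /-- `edge a h`: the agent `a` has the chosen utility for the house `h` -/
  | edge
  /-- `own a h`: the agent `a` owns the house `h` -/
  | own
  /-- `price h j`: the price of the house `h` is larger than `j` -/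
  | price
  /-- `asg 0 a`: the agent `a` owns a house -/
  | asg
  /-- `eq 0 0`: the compared utilities agree -/
  | eq
  /-- `ok 0 0`: all agents own a house -/
  | ok
  /-- `ans 0 0`: the answer -/
  | ans
  deriving DecidableEq

instance : Fintype Arr :=
  ⟨{Arr.inp, .depth, .cont, .row, .col, .agents, .edge, .own, .price, .asg, .eq, .ok, .ans},
    fun r => by cases r <;> decide⟩

/-- The variables of the decision procedure. -/
inductive Var : Type
  | zero | pos | cell | agent | house | off | value | other | level | time | time'
  deriving DecidableEq

instance : Fintype Var :=
  ⟨{Var.zero, .pos, .cell, .agent, .house, .off, .value, .other, .level, .time, .time'},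
    fun x => by cases x <;> decide⟩

open Arr Var

/-- Sequential composition. -/
local infixr:60 " ;; " => Prog.seq

/-- Take the house from its owner. -/
def kick : Prog Arr Var :=
  forEach other (when own other house
    (set own other house Γ'.blank ;; set asg zero other Γ'.blank))

/-- The agent takes the house, whose price becomes `level + 1`. -/
def take : Prog Arr Var :=
  kick ;; set own agent house mark ;; set asg zero agent mark ;; set price house level mark

/-- The agent takes the house if it needs and accepts it and the price is at most `level`. -/
def bid : Prog Arr Var :=
  whenNot asg zero agent (when edge agent house (whenNot price house level take))

/-- The agent takes one of the cheapest houses if it needs one. -/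
def seek : Prog Arr Var := forEach level (forEach house bid)

/-- All agents make their moves. -/
def round : Prog Arr Var := forEach agent seek

/-- No agent owns a house, all prices are zero. -/
def clear : Prog Arr Var :=
  forEach agent (forEach house (set own agent house Γ'.blank ;; set price agent house Γ'.blank) ;;
    set asg zero agent Γ'.blank)

/-- Compute a matching that covers all agents, if there is one. -/
def auction : Prog Arr Var := clear ;; forEach time (forEach time' round)

/-- The contents of the arrays. -/
abbrev Arrays : Type := Arr → ℕ → ℕ → Γ'

theorem run_kick {N : ℕ} {s : State Arr Var} (hz : s.v zero = 0) :
    (∀ b h, On (run N kick s).A own b h ↔ On s.A own b h ∧ ¬(b < N ∧ h = s.v house)) ∧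
    ∀ b, On (run N kick s).A asg 0 b ↔ On s.A asg 0 b ∧ ¬(b < N ∧ On s.A own b (s.v house)) := by
  refine run_forEach_induction (fun k A =>
    (∀ b h, On A own b h ↔ On s.A own b h ∧ ¬(b < k ∧ h = s.v house)) ∧
    ∀ b, On A asg 0 b ↔ On s.A asg 0 b ∧ ¬(b < k ∧ On s.A own b (s.v house))) (by simp) ?_
  rintro i s' hi - hv hvi ⟨h1, h2⟩
  have hz' : s'.v zero = 0 := (hv zero (by decide) rfl).trans hz
  have hh : s'.v house = s.v house := hv house (by decide) rfl
  -- Row `i` is untouched before iteration `i`, so the test reads the original ownership.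
  have hi' : On s'.A own i (s.v house) ↔ On s.A own i (s.v house) := by simp [h1]
  rw [run_when, hvi, hh]
  split_ifs with hon
  · rw [hi'] at hon
    simp only [run, State.setA, hvi, hh, hz']
    constructor
    · intro b h
      by_cases hb : b = i ∧ h = s.v house
      · simp [hb]
      · simp only [On, true_and, hb, if_false, reduceCtorEq, false_and]
        rw [show (s'.A own b h = mark ↔ _) from h1 b h]
        constructor
        · rintro ⟨h3, h4⟩; exact ⟨h3, by rintro ⟨h5, h6⟩; omega⟩
        · rintro ⟨h3, h4⟩; exact ⟨h3, by rintro ⟨h5, h6⟩; omega⟩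
    · intro b
      by_cases hb : b = i
      · subst hb; simp [hon]
      · simp only [On, true_and, hb, if_false, reduceCtorEq, false_and]
        rw [show (s'.A asg 0 b = mark ↔ _) from h2 b]
        have : b < i ↔ b < i + 1 := by omega
        rw [this]
  · rw [hi'] at hon
    refine ⟨fun b h => (h1 b h).trans ?_, fun b => (h2 b).trans ?_⟩
    · refine and_congr_right fun h3 => not_congr ⟨fun h4 => ⟨by omega, h4.2⟩, fun h4 => ⟨?_, h4.2⟩⟩
      have : b ≠ i := by rintro rfl; exact hon (h4.2 ▸ h3)
      omega
    · refine and_congr_right fun _ => not_congr ⟨fun h4 => ⟨by omega, h4.2⟩, fun h4 => ⟨?_, h4.2⟩⟩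
      have : b ≠ i := by rintro rfl; exact hon h4.2
      omega

/-- The arrays represent a state of the auction. -/
def IsAuction (n m N : ℕ) (E : ℕ → ℕ → Prop) (A : Arrays) : Prop :=
  Auction n m N E (On A own) (On A price) (On A asg 0)

/-- The states of the auction are the same. -/
def SameAuction (A B : Arrays) : Prop :=
  A own = B own ∧ A price = B price ∧ A asg = B asg

theorem SameAuction.isAuction {n m N : ℕ} {E : ℕ → ℕ → Prop} {A B : Arrays}
    (h : SameAuction A B) (hB : IsAuction n m N E B) : IsAuction n m N E A := by
  unfold IsAuction On at *
  rwa [h.1, h.2.1, h.2.2]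

theorem SameAuction.price {A B : Arrays} (h : SameAuction A B) :
    On A Arr.price = On B Arr.price := by
  unfold On
  rw [h.2.1]

theorem run_take {n m N : ℕ} {E : ℕ → ℕ → Prop} {s : State Arr Var} (hz : s.v zero = 0)
    (hA : IsAuction n m N E s.A) (hnN : n ≤ N) (hj : s.v level < N)
    (hF : ¬On s.A asg 0 (s.v agent)) (hE : E (s.v agent) (s.v house))
    (hP : ¬On s.A price (s.v house) (s.v level))
    (hmin : ∀ h i, i < s.v level → E (s.v agent) h → On s.A price h i) :
    IsAuction n m N E (run N take s).A ∧ On (run N take s).A asg 0 (s.v agent) ∧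
      totalPrice (On (run N take s).A price) = totalPrice (On s.A price) + 1 := by
  obtain ⟨h1, h2⟩ := run_kick (N := N) hz
  have hlt : ∀ {b h}, On s.A own b h → b < N := fun hb =>
    (hA.edge_lt (hA.own_edge hb)).1.trans_le hnN
  have hv : ∀ x, kick.assigns x = false → (run N kick s).v x = s.v x :=
    fun x hx => run_v_of_not_assigns hx s
  have hP' : ∀ k i, On (run N take s).A price k i ↔
      On s.A price k i ∨ k = s.v house ∧ i = s.v level := by
    intro k i
    have h3 : (run N kick s).A price = s.A price := run_A_of_not_writes rfl s
    simp only [take, run, State.setA, hv zero rfl, hv agent rfl, hv house rfl, hv level rfl, hz, On]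
    by_cases hk : k = s.v house ∧ i = s.v level
    · simp [hk]
    · simp [hk, h3]
  have hF' : ∀ b, On (run N take s).A asg 0 b ↔
      b = s.v agent ∨ On s.A asg 0 b ∧ ¬On s.A own b (s.v house) := by
    intro b
    simp only [take, run, State.setA, hv zero rfl, hv agent rfl, hv house rfl, hv level rfl, hz, On]
    by_cases hb : b = s.v agent
    · simp [hb]
    · simp only [reduceCtorEq, false_and, if_false, true_and, hb, false_or]
      rw [show ((run N kick s).A asg 0 b = mark ↔ _) from h2 b]
      exact and_congr_right fun _ => not_congr ⟨fun h => h.2, fun h => ⟨hlt h, h⟩⟩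
  refine ⟨hA.take hF hE hj hmin hP ?_ hP' hF', (hF' _).2 (.inl rfl), hA.totalPrice_take hP hP'⟩
  intro b k
  simp only [take, run, State.setA, hv zero rfl, hv agent rfl, hv house rfl, hv level rfl, hz, On]
  by_cases hk : k = s.v house
  · subst hk
    by_cases hb : b = s.v agent
    · simp [hb]
    · simp only [reduceCtorEq, false_and, if_false, true_and, hb, if_true, iff_false]
      rw [show ((run N kick s).A own b (s.v house) = mark ↔ _) from h1 b _]
      exact fun h => h.2 ⟨hlt h.1, rfl⟩
  · simp only [reduceCtorEq, false_and, if_false, hk, and_false]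
    rw [show ((run N kick s).A own b k = mark ↔ _) from h1 b _]
    simp [hk]

/-- The situation after an agent that needed a house has taken one. -/
def Taken (n m N : ℕ) (E : ℕ → ℕ → Prop) (A : Arrays) (a : ℕ) (B : Arrays) : Prop :=
  ¬On A asg 0 a ∧ IsAuction n m N E B ∧ On B asg 0 a ∧
    totalPrice (On B price) = totalPrice (On A price) + 1

/-- Levels are scanned upwards, so the first accepted house whose price does not exceed the level is
a cheapest one; this is the condition `hmin` of `Auction.take`. Once the agent has a house, all
further bids do nothing. If a homeless agent finds no house at any level, all houses that it accepts
have price at least `N`. -/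
theorem run_seek {n m N : ℕ} {E : ℕ → ℕ → Prop} {s : State Arr Var} (hz : s.v zero = 0)
    (hE : ∀ a h, On s.A edge a h ↔ E a h) (hA : IsAuction n m N E s.A) (hnN : n ≤ N)
    (hmN : m ≤ N) :
    SameAuction (run N seek s).A s.A ∧
        (On s.A asg 0 (s.v agent) ∨ ∀ h i, i < N → E (s.v agent) h → On s.A price h i) ∨
      Taken n m N E s.A (s.v agent) (run N seek s).A := by
  refine run_forEach_induction (fun j A => SameAuction A s.A ∧
        (On s.A asg 0 (s.v agent) ∨ ∀ h i, i < j → E (s.v agent) h → On s.A price h i) ∨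
      Taken n m N E s.A (s.v agent) A) (.inl ⟨⟨rfl, rfl, rfl⟩, .inr (by simp)⟩) ?_
  intro j s₁ hj hA₁ hv₁ hvj h₁
  -- Invariant of the scan at level `j`: lower levels are exhausted, and so are the houses below `k`
  -- at this level.
  have key : SameAuction (run N (forEach house bid) s₁).A s.A ∧
        (On s.A asg 0 (s.v agent) ∨ (∀ h i, i < j → E (s.v agent) h → On s.A price h i) ∧
          ∀ h < N, E (s.v agent) h → On s.A price h j) ∨
      Taken n m N E s.A (s.v agent) (run N (forEach house bid) s₁).A := by
    refine run_forEach_induction (fun k A => SameAuction A s.A ∧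
        (On s.A asg 0 (s.v agent) ∨ (∀ h i, i < j → E (s.v agent) h → On s.A price h i) ∧
          ∀ h < k, E (s.v agent) h → On s.A price h j) ∨
      Taken n m N E s.A (s.v agent) A) ?_ ?_
    · rcases h₁ with ⟨h1, h2⟩ | h1
      · exact .inl ⟨h1, h2.imp_right fun h => ⟨h, by simp⟩⟩
      · exact .inr h1
    intro k s₂ hk hA₂ hv₂ hvk h₂
    have hz₂ : s₂.v zero = 0 :=
      (hv₂ zero (by decide) rfl).trans ((hv₁ zero (by decide) rfl).trans hz)
    have ha₂ : s₂.v agent = s.v agent :=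
      (hv₂ agent (by decide) rfl).trans (hv₁ agent (by decide) rfl)
    have hl₂ : s₂.v level = j := (hv₂ level (by decide) rfl).trans hvj
    have hE₂ : ∀ a h, On s₂.A edge a h ↔ E a h := fun a h => by
      rw [On, hA₂ edge rfl, hA₁ edge rfl]; exact hE a h
    rw [bid, run_whenNot, hz₂, ha₂]
    rcases h₂ with ⟨h1, h2⟩ | h1
    · have hasg : ∀ a, On s₂.A asg 0 a ↔ On s.A asg 0 a := fun a => by rw [On, h1.2.2]
      have hprice : ∀ a h, On s₂.A price a h ↔ On s.A price a h := fun a h => by rw [On, h1.2.1]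
      split_ifs with hasgd
      · exact .inl ⟨h1, .inl ((hasg _).1 hasgd)⟩
      · rw [hasg] at hasgd
        have h3 := h2.resolve_left hasgd
        rw [run_when, ha₂, hvk]
        split_ifs with hedge
        · rw [hE₂] at hedge
          rw [run_whenNot, hvk, hl₂]
          split_ifs with hpr
          · rw [hprice] at hpr
            refine .inl ⟨h1, .inr ⟨h3.1, fun h hh hE => ?_⟩⟩
            rcases Nat.lt_succ_iff_lt_or_eq.1 hh with hh | rfl
            · exact h3.2 h hh hE
            · exact hpr
          · have := run_take (N := N) hz₂ (h1.isAuction hA) hnN (by rw [hl₂]; exact hj)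
              (by rwa [ha₂, hasg]) (by rwa [ha₂, hvk]) (by rwa [hvk, hl₂])
              (fun h i hi hE => by
                rw [hl₂] at hi
                rw [ha₂] at hE
                exact (hprice _ _).2 (h3.1 h i hi hE))
            rw [ha₂, h1.price] at this
            exact .inr ⟨hasgd, this⟩
        · refine .inl ⟨h1, .inr ⟨h3.1, fun h hh hE => ?_⟩⟩
          rcases Nat.lt_succ_iff_lt_or_eq.1 hh with hh | rfl
          · exact h3.2 h hh hE
          · exact absurd ((hE₂ _ _).2 hE) hedge
    · rw [if_pos h1.2.2.1]
      exact .inr h1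
  rcases key with ⟨h1, h2⟩ | h1
  · refine .inl ⟨h1, h2.imp_right fun h h' i hi hE => ?_⟩
    rcases Nat.lt_succ_iff_lt_or_eq.1 hi with hi | rfl
    · exact h.1 h' i hi hE
    · exact h.2 h' ((hA.edge_lt hE).2.trans_le hmN) hE
  · exact .inr h1

/-- Three outcomes: a homeless agent fails while the auction is unchanged, which excludes a matching
by `Auction.not_hasMatching`; nobody was homeless and nothing changes; or some agent has taken a
house, which raises the total price. -/
theorem run_round {n m N : ℕ} {E : ℕ → ℕ → Prop} {s : State Arr Var} (hz : s.v zero = 0)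
    (hE : ∀ a h, On s.A edge a h ↔ E a h) (hA : IsAuction n m N E s.A) (hnN : n ≤ N)
    (hmN : m ≤ N) :
    IsAuction n m N E (run N round s).A ∧ (¬HasMatching n E ∨
      (SameAuction (run N round s).A s.A ∧ ∀ a < n, On s.A asg 0 a) ∨
      (∃ a < n, ¬On s.A asg 0 a) ∧ totalPrice (On s.A price) + 1 ≤ totalPrice (On (run N round s).A price)) := by
  have := run_forEach_induction (N := N) (x := agent) (P := seek) (s := s) (fun i A =>
    IsAuction n m N E A ∧ (¬HasMatching n E ∨
      (SameAuction A s.A ∧ ∀ a < i, a < n → On s.A asg 0 a) ∨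
      (∃ a < n, ¬On s.A asg 0 a) ∧ totalPrice (On s.A price) + 1 ≤ totalPrice (On A price)))
    ⟨hA, .inr (.inl ⟨⟨rfl, rfl, rfl⟩, by simp⟩)⟩ ?_
  · refine ⟨this.1, this.2.imp_right (.imp_left fun h => ⟨h.1, fun a ha => ?_⟩)⟩
    exact h.2 a (ha.trans_le hnN) ha
  rintro i s' hi hA' hv hvi ⟨h1, h2⟩
  have hz' : s'.v zero = 0 := (hv zero (by decide) rfl).trans hz
  have hE' : ∀ a h, On s'.A edge a h ↔ E a h := fun a h => by
    rw [On, hA' edge rfl]; exact hE a h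
  rcases run_seek hz' hE' h1 hnN hmN with ⟨h3, h4⟩ | ⟨h0, h3, h4, h5⟩
  · refine ⟨h3.isAuction h1, ?_⟩
    rcases h2 with h2 | ⟨h2, h2'⟩ | h2
    · exact .inl h2
    · rw [hvi] at h4
      have hasg : ∀ a, On s'.A asg 0 a ↔ On s.A asg 0 a := fun a => by rw [On, h2.2.2]
      by_cases hin : i < n ∧ ¬On s.A asg 0 i
      · exact .inl (h1.not_hasMatching hnN hin.1 (by rw [hasg]; exact hin.2) fun h j hj hE =>
          (h4.resolve_left (by rw [hasg]; exact hin.2)) h j hj hE)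
      · refine .inr (.inl ⟨⟨h3.1.trans h2.1, h3.2.1.trans h2.2.1, h3.2.2.trans h2.2.2⟩,
          fun a ha han => ?_⟩)
        rcases Nat.lt_succ_iff_lt_or_eq.1 ha with ha | rfl
        · exact h2' a ha han
        · by_contra h6
          exact hin ⟨han, h6⟩
    · refine .inr (.inr ?_)
      rwa [h3.price]
  · refine ⟨h3, ?_⟩
    rcases h2 with h2 | ⟨h2, -⟩ | h2
    · exact .inl h2
    · obtain ⟨h, hO⟩ := (h3.assigned _).1 h4
      refine .inr (.inr ⟨⟨_, (h3.edge_lt (h3.own_edge hO)).1, ?_⟩, ?_⟩)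
      · rwa [On, ← h2.2.2]
      · rw [h5, h2.price]
    · exact .inr (.inr ⟨h2.1, by omega⟩)

/-- The arrays of the auction have no marks outside of the range of the loops. -/
structure Small (N : ℕ) (A : Arrays) : Prop where
  own : ∀ a h, On A own a h → a < N ∧ h < N
  price : ∀ h j, On A price h j → h < N ∧ j < N
  asg : ∀ a, On A asg 0 a → a < N

theorem IsAuction.small {n m N : ℕ} {E : ℕ → ℕ → Prop} {A : Arrays} (hA : IsAuction n m N E A)
    (hnN : n ≤ N) (hmN : m ≤ N) : Small N A where
  own a h hO := by
    have := hA.edge_lt (hA.own_edge hO)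
    omega
  price h j hP := by
    have := hA.price_lt hP
    omega
  asg a hF := by
    obtain ⟨h, hO⟩ := (hA.assigned a).1 hF
    have := hA.edge_lt (hA.own_edge hO)
    omega

/-- The loops erase only indices below `N`. The marks left by an auction for an earlier utility lie
in this range, which is what `Small` records. -/
theorem run_clear {N : ℕ} {s : State Arr Var} (hz : s.v zero = 0) (hs : Small N s.A) :
    (∀ a h, ¬On (run N clear s).A own a h) ∧ (∀ a h, ¬On (run N clear s).A price a h) ∧
      ∀ a, ¬On (run N clear s).A asg 0 a := by
  suffices h : (∀ a h, On (run N clear s).A own a h → On s.A own a h ∧ (a < N → N ≤ h)) ∧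
      (∀ a h, On (run N clear s).A price a h → On s.A price a h ∧ (a < N → N ≤ h)) ∧
      ∀ a, On (run N clear s).A asg 0 a → On s.A asg 0 a ∧ N ≤ a by
    refine ⟨fun a k hk => ?_, fun a k hk => ?_, fun a ha => ?_⟩
    · obtain ⟨h1, h2⟩ := h.1 a k hk
      have := hs.own a k h1
      have := h2 this.1
      omega
    · obtain ⟨h1, h2⟩ := h.2.1 a k hk
      have := hs.price a k h1
      have := h2 this.1
      omega
    · obtain ⟨h1, h2⟩ := h.2.2 a ha
      have := hs.asg a h1
      omega
  refine run_forEach_induction (fun i A =>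
    (∀ a h, On A own a h → On s.A own a h ∧ (a < i → N ≤ h)) ∧
      (∀ a h, On A price a h → On s.A price a h ∧ (a < i → N ≤ h)) ∧
      ∀ a, On A asg 0 a → On s.A asg 0 a ∧ i ≤ a) (by simp) ?_
  rintro i s₁ hi _ hv₁ hvi ⟨ho, hp, ha⟩
  have hz₁ : s₁.v zero = 0 := (hv₁ zero (by decide) rfl).trans hz
  set P := forEach house (set own agent house Γ'.blank ;; set price agent house Γ'.blank) with hP
  have inner : (∀ a h, On (run N P s₁).A own a h →
        On s.A own a h ∧ (a < i → N ≤ h) ∧ (a = i → N ≤ h)) ∧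
      (∀ a h, On (run N P s₁).A price a h →
        On s.A price a h ∧ (a < i → N ≤ h) ∧ (a = i → N ≤ h)) := by
    refine run_forEach_induction (N := N) (fun k A =>
      (∀ a h, On A own a h → On s.A own a h ∧ (a < i → N ≤ h) ∧ (a = i → k ≤ h)) ∧
      (∀ a h, On A price a h → On s.A price a h ∧ (a < i → N ≤ h) ∧ (a = i → k ≤ h)))
      ⟨fun a h hh => ⟨(ho a h hh).1, (ho a h hh).2, fun _ => Nat.zero_le _⟩,
        fun a h hh => ⟨(hp a h hh).1, (hp a h hh).2, fun _ => Nat.zero_le _⟩⟩ ?_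
    rintro k s₂ hk _ hv₂ hvk ⟨ho₂, hp₂⟩
    have ha₂ : s₂.v agent = i := (hv₂ agent (by decide) rfl).trans hvi
    have aux : ∀ {a h}, ¬(a = i ∧ h = k) → (a = i → k ≤ h) → a = i → k + 1 ≤ h := by omega
    simp only [run, State.setA, hvk, ha₂, On]
    constructor
    · intro a h hh
      by_cases hah : a = i ∧ h = k
      · simp [hah] at hh
      · have := ho₂ a h (by simpa [hah] using hh)
        exact ⟨this.1, this.2.1, aux hah this.2.2⟩
    · intro a h hh
      by_cases hah : a = i ∧ h = k
      · simp [hah] at hh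
      · have := hp₂ a h (by simpa [hah] using hh)
        exact ⟨this.1, this.2.1, aux hah this.2.2⟩
  have hasg : (run N P s₁).A asg = s₁.A asg := run_A_of_not_writes rfl s₁
  have hagent : (run N P s₁).v agent = i := (run_v_of_not_assigns rfl s₁).trans hvi
  have hzero : (run N P s₁).v zero = 0 := (run_v_of_not_assigns rfl s₁).trans hz₁
  have aux : ∀ {a h}, (a < i → N ≤ h) ∧ (a = i → N ≤ h) → a < i + 1 → N ≤ h := by omega
  rw [run]
  simp only [run.eq_2, State.setA, On, hagent, hzero, hasg]
  refine ⟨fun a h hh => ?_, fun a h hh => ?_, fun a hh => ?_⟩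
  · have := inner.1 a h (by simpa using hh)
    exact ⟨this.1, aux this.2⟩
  · have := inner.2 a h (by simpa using hh)
    exact ⟨this.1, aux this.2⟩
  · by_cases hai : a = i
    · simp [hai] at hh
    · have := ha a (by simpa [hai] using hh)
      exact ⟨this.1, by omega⟩

/-- The two nested loops provide `N * N` rounds. If a matching exists and some agent were still
homeless, the total price would have reached `N * N`, but it is at most `m * N`, which is smaller
since `m < N`. Conversely, if all agents own houses, the ownership is a matching. -/
theorem run_auction {n m N : ℕ} {E : ℕ → ℕ → Prop} {s : State Arr Var} (hz : s.v zero = 0)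
    (hE : ∀ a h, On s.A edge a h ↔ E a h) (hlt : ∀ a h, E a h → a < n ∧ h < m) (hnN : n ≤ N)
    (hmN : m < N) (hs : Small N s.A) :
    Small N (run N auction s).A ∧
      ((∀ a < n, On (run N auction s).A asg 0 a) ↔ HasMatching n E) := by
  obtain ⟨h1, h2, h3⟩ := run_clear hz hs
  have hA : IsAuction n m N E (run N clear s).A :=
    ⟨fun h => hlt _ _ h, fun h => absurd h (h1 _ _), fun h => absurd h (h1 _ _),
      fun h => absurd h (h1 _ _), fun a => ⟨fun h => absurd h (h3 a), fun ⟨h, hh⟩ => absurd hh (h1 a h)⟩,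
      fun h => absurd h (h2 _ _), fun h => absurd h (h2 _ _), fun h => absurd h (h2 _ _),
      fun h => absurd h (h1 _ _)⟩
  have hz₀ : (run N clear s).v zero = 0 := (run_v_of_not_assigns rfl s).trans hz
  have hE₀ : ∀ a h, On (run N clear s).A edge a h ↔ E a h := fun a h => by
    rw [On, run_A_of_not_writes rfl s]; exact hE a h
  have key : IsAuction n m N E (run N auction s).A ∧ (¬HasMatching n E ∨
      (∀ a < n, On (run N auction s).A asg 0 a) ∨
      N * N ≤ totalPrice (On (run N auction s).A price)) := by
    refine run_forEach_induction (N := N) (x := time) (P := forEach time' round)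
      (s := run N clear s) (fun i A => IsAuction n m N E A ∧ (¬HasMatching n E ∨
        (∀ a < n, On A asg 0 a) ∨ i * N ≤ totalPrice (On A price)))
      ⟨hA, .inr (.inr (by simp))⟩ ?_
    intro i s₁ hi hA₁ hv₁ _ h₁
    have := run_forEach_induction (N := N) (x := time') (P := round)
      (s := s₁) (fun k A => IsAuction n m N E A ∧ (¬HasMatching n E ∨
        (∀ a < n, On A asg 0 a) ∨ i * N + k ≤ totalPrice (On A price))) h₁ (by
        rintro k s₂ hk hA₂ hv₂ - ⟨h4, h5⟩
        have hz₂ : s₂.v zero = 0 :=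
          (hv₂ zero (by decide) rfl).trans ((hv₁ zero (by decide) rfl).trans hz₀)
        have hE₂ : ∀ a h, On s₂.A edge a h ↔ E a h := fun a h => by
          rw [On, hA₂ edge rfl, hA₁ edge rfl]; exact hE₀ a h
        obtain ⟨h6, h7⟩ := run_round hz₂ hE₂ h4 hnN hmN.le
        refine ⟨h6, ?_⟩
        rcases h7 with h7 | ⟨h7, h8⟩ | h7
        · exact .inl h7
        · refine .inr (.inl fun a ha => ?_)
          rw [On, h7.2.2]
          exact h8 a ha
        · rcases h5 with h5 | h5 | h5
          · exact .inl h5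
          · obtain ⟨a, ha, ha'⟩ := h7.1
            exact absurd (h5 a ha) ha'
          · exact .inr (.inr (by omega)))
    rw [Nat.succ_mul]
    exact this
  refine ⟨key.1.small hnN hmN.le, fun h => key.1.hasMatching h, fun h => ?_⟩
  rcases key.2 with h4 | h4 | h4
  · exact absurd h h4
  · exact h4
  · have := key.1.totalPrice_le
    have : m * N < N * N := Nat.mul_lt_mul_of_pos_right hmN (by omega)
    omega

end HouseProgram

end

/-! ### The graph of a utility and the search over all utilities -/

section

open Computability Function

namespace ArrayProgram

variable {R V : Type} [DecidableEq R] [DecidableEq V]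

/-- Branch on the symbol in an array element. -/
def Prog.switch (r : R) (x y : V) (f : Γ' → Prog R V) : Prog R V :=
  .tst r x y (· = .blank) (f .blank) (.tst r x y (· = .bra) (f .bra)
    (.tst r x y (· = .ket) (f .ket) (.tst r x y (· = .comma) (f .comma)
      (.tst r x y (· = .bit true) (f (.bit true)) (f (.bit false))))))

theorem run_switch (N : ℕ) (r : R) (x y : V) (f : Γ' → Prog R V) (s : State R V) :
    run N (.switch r x y f) s = run N (f (s.A r (s.v x) (s.v y))) s := by
  rcases h : s.A r (s.v x) (s.v y) with _ | ⟨_ | _⟩ | _ | _ | _ <;> simp [Prog.switch, run, h]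

end ArrayProgram

namespace HouseProgram

open ArrayProgram ArrayProgram.Prog Arr Var

/-- Sequential composition. -/
local infixr:60 " ;; " => Prog.seq

/-- Compare two utilities. -/
def compare : Prog Arr Var :=
  set eq zero zero mark ;; forEach off (switch cont cell off fun c =>
    tst cont value off (· = c) skip (set eq zero zero Γ'.blank))

/-- Record the result of a comparison in the array `edge`. -/
def link : Prog Arr Var :=
  forEach agent (when row cell agent (forEach house (when col cell house
    (tst eq zero zero (· = mark) (set edge agent house mark) (set edge agent house Γ'.blank)))))

/-- Compute the graph of the chosen utility. -/
def edges : Prog Arr Var := forEach cell (compare ;; link)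

/-- The answer is positive if all agents own a house. -/
def check : Prog Arr Var :=
  set ok zero zero mark ;; forEach agent (when agents zero agent
    (whenNot asg zero agent (set ok zero zero Γ'.blank))) ;;
    when ok zero zero (set ans zero zero mark)

/-- Try all utilities. -/
def search : Prog Arr Var := forEach value (edges ;; auction ;; check)

/-- The arrays after parsing: there are `n` agents, `m` houses and utilities `u`. -/
structure Parsed (n m : ℕ) (u : ℕ → List Γ') (A : Arrays) : Prop where
  cont : ∀ c i, A cont c i = if c < n * m then (u c).getD i Γ'.blank else Γ'.blank
  row : ∀ c a, On A row c a ↔ c < n * m ∧ a = c / m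
  col : ∀ c h, On A col c h ↔ c < n * m ∧ h = c % m
  agents : ∀ a, On A agents 0 a ↔ a < n

/-- Two utilities in the array `cont` agree. -/
def SameUtility (N : ℕ) (A : Arrays) (c c' : ℕ) : Prop :=
  ∀ i < N, A Arr.cont c i = A Arr.cont c' i

theorem run_compare {N : ℕ} {s : State Arr Var} (hz : s.v zero = 0) :
    On (run N compare s).A eq 0 0 ↔ SameUtility N s.A (s.v cell) (s.v value) := by
  refine run_forEach_induction (s := run N (set eq zero zero mark) s) (fun k A =>
    On A eq 0 0 ↔ SameUtility k s.A (s.v cell) (s.v value)) ?_ ?_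
  · simp [run, State.setA, hz, SameUtility]
  intro i s' hi hA hv hvi h
  have hz' : s'.v zero = 0 := (hv zero (by decide) rfl).trans hz
  have hc : s'.v cell = s.v cell := hv cell (by decide) rfl
  have hv' : s'.v value = s.v value := hv value (by decide) rfl
  have hcont : s'.A cont = s.A cont := by
    rw [hA cont rfl, run_A_of_not_writes rfl]
  rw [run_switch, hvi, hc, hcont, run, hvi, hv', hcont]
  have step : SameUtility (i + 1) s.A (s.v cell) (s.v value) ↔
      SameUtility i s.A (s.v cell) (s.v value) ∧
        s.A cont (s.v cell) i = s.A cont (s.v value) i := by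
    unfold SameUtility
    rw [Nat.forall_lt_succ_right]
  rw [step]
  split_ifs with heq
  · rw [run, h]
    simp [of_decide_eq_true heq]
  · have : s.A cont (s.v cell) i ≠ s.A cont (s.v value) i := fun h' => heq (by simp [h'])
    simp [run, State.setA, hz', this]

/-- The arrays `row` and `col` tell which agent and house the current utility belongs to, so the
program needs no division by `m`. -/
theorem run_link {N : ℕ} {s : State Arr Var} (hz : s.v zero = 0) (a h : ℕ) :
    On (run N link s).A edge a h ↔
      if a < N ∧ h < N ∧ On s.A row (s.v cell) a ∧ On s.A col (s.v cell) h then On s.A eq 0 0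
      else On s.A edge a h := by
  revert a h
  refine run_forEach_induction (fun k A => ∀ a h, On A edge a h ↔
      if a < k ∧ h < N ∧ On s.A row (s.v cell) a ∧ On s.A col (s.v cell) h then On s.A eq 0 0
      else On s.A edge a h) (by simp) ?_
  intro i s₁ hi hA₁ hv₁ hvi h₁ a h
  have hc₁ : s₁.v cell = s.v cell := hv₁ cell (by decide) rfl
  have hrow : s₁.A row = s.A row := hA₁ row rfl
  rw [run_when, hvi, hc₁]
  by_cases hon : On s₁.A row (s.v cell) i
  · rw [if_pos hon]
    rw [On, hrow] at hon
    revert a h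
    have := run_forEach_induction (N := N) (x := house) (P := when col cell house
      (tst eq zero zero (· = mark) (set edge agent house mark) (set edge agent house Γ'.blank)))
      (s := s₁) (fun k A => ∀ a h, On A edge a h ↔
        if (a < i ∧ h < N ∨ a = i ∧ h < k) ∧ On s.A row (s.v cell) a ∧ On s.A col (s.v cell) h then
          On s.A eq 0 0 else On s.A edge a h) (fun a h => by
        rw [h₁ a h]; simp [and_assoc]) (by
      intro k s₂ hk hA₂ hv₂ hvk h₂ a h
      have hz₂ : s₂.v zero = 0 :=
        (hv₂ zero (by decide) rfl).trans ((hv₁ zero (by decide) rfl).trans hz)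
      have hc₂ : s₂.v cell = s.v cell := (hv₂ cell (by decide) rfl).trans hc₁
      have ha₂ : s₂.v agent = i := (hv₂ agent (by decide) rfl).trans hvi
      have hcol : s₂.A col = s.A col := (hA₂ col rfl).trans (hA₁ col rfl)
      have heq : s₂.A eq = s.A eq := (hA₂ eq rfl).trans (hA₁ eq rfl)
      rw [run_when, hvk, hc₂]
      have hsucc : (a < i ∧ h < N ∨ a = i ∧ h < k + 1) ↔
          (a < i ∧ h < N ∨ a = i ∧ h < k) ∨ a = i ∧ h = k := by omega
      simp only [hsucc]
      have hset : ∀ c, On (run N (set edge agent house c) s₂).A edge a h ↔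
          if a = i ∧ h = k then c = mark else On s₂.A edge a h := fun c => by
        by_cases hah : a = i ∧ h = k <;> simp [run, State.setA, hah, hvk, ha₂, On]
      have hedge : On (run N (tst eq zero zero (· = mark) (set edge agent house mark)
          (set edge agent house Γ'.blank)) s₂).A edge a h ↔
          if a = i ∧ h = k then On s.A eq 0 0 else On s₂.A edge a h := by
        rw [run, hz₂, heq]
        by_cases he : s.A eq 0 0 = mark
        · rw [if_pos (by simpa using he), hset]; by_cases hah : a = i ∧ h = k <;> simp [he, hah, On]
        · rw [if_neg (by simpa using he), hset]; by_cases hah : a = i ∧ h = k <;> simp [he, hah, On]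
      split_ifs with h3 h4 h4
      · rw [hedge]
        by_cases hah : a = i ∧ h = k
        · rw [if_pos hah]
        · rw [if_neg hah, h₂ a h, if_pos ⟨h4.1.resolve_right hah, h4.2⟩]
      · rw [On, hcol] at h3
        have hah : ¬(a = i ∧ h = k) := by
          rintro ⟨rfl, rfl⟩
          exact h4 ⟨.inr ⟨rfl, rfl⟩, hon, h3⟩
        rw [hedge, if_neg hah, h₂ a h, if_neg fun h' => h4 ⟨.inl h'.1, h'.2⟩]
      · have hah : ¬(a = i ∧ h = k) := by
          rintro ⟨rfl, rfl⟩
          rw [On, hcol] at h3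
          exact h3 h4.2.2
        rw [h₂ a h, if_pos ⟨h4.1.resolve_right hah, h4.2⟩]
      · rw [h₂ a h, if_neg fun h' => h4 ⟨.inl h'.1, h'.2⟩])
    intro a h
    refine (this a h).trans ?_
    have e : (a < i ∧ h < N ∨ a = i ∧ h < N) ↔ a < i + 1 ∧ h < N := by omega
    simp only [e, and_assoc]
  · rw [if_neg hon]
    rw [On, hrow] at hon
    rw [h₁ a h]
    by_cases hai : a = i
    · subst hai
      simp [hon, On]
    · have e : a < i + 1 ↔ a < i := by omega
      simp only [e]

/-- The edges of the graph of a chosen utility. -/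
def Edge (n m N : ℕ) (A : Arrays) (c a h : ℕ) : Prop :=
  a < n ∧ h < m ∧ SameUtility N A (a * m + h) c

/-- The entry of the pair `a`, `h` is rewritten when `cell` is `a * m + h`, and at no other time. As
`n * m ≤ N`, every entry in range is reached, so nothing survives from the graph of an earlier
utility; by `he`, no old edges lie out of range. -/
theorem run_edges {n m N : ℕ} {u : ℕ → List Γ'} {s : State Arr Var} (hz : s.v zero = 0)
    (hs : Parsed n m u s.A) (hnm : n * m ≤ N) (hn : n ≤ N) (hm : m ≤ N)
    (he : ∀ a h, On s.A edge a h → a < n ∧ h < m) (a h : ℕ) :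
    On (run N edges s).A edge a h ↔ Edge n m N s.A (s.v value) a h := by
  have key := run_forEach_induction (N := N) (x := cell) (P := compare ;; link) (s := s)
    (fun k A => ∀ a h, On A edge a h ↔ a < n ∧ h < m ∧
      if a * m + h < k then SameUtility N s.A (a * m + h) (s.v value) else On s.A edge a h)
    (fun a h => by
      rw [if_neg (Nat.not_lt_zero _)]
      exact ⟨fun h' => ⟨(he a h h').1, (he a h h').2, h'⟩, fun h' => h'.2.2⟩) (by
    intro i s₁ hi hA₁ hv₁ hvi h₁ a h
    have hz₁ : s₁.v zero = 0 := (hv₁ zero (by decide) rfl).trans hz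
    have hval : s₁.v value = s.v value := hv₁ value (by decide) rfl
    have hcmp := run_compare (N := N) hz₁
    have hcont : s₁.A cont = s.A cont := hA₁ cont rfl
    rw [hvi, hval, SameUtility, hcont] at hcmp
    have hz₂ : (run N compare s₁).v zero = 0 := (run_v_of_not_assigns rfl s₁).trans hz₁
    have hc₂ : (run N compare s₁).v cell = i := (run_v_of_not_assigns rfl s₁).trans hvi
    have hrow : (run N compare s₁).A row = s.A row :=
      (run_A_of_not_writes rfl s₁).trans (hA₁ row rfl)
    have hcol : (run N compare s₁).A col = s.A col :=
      (run_A_of_not_writes rfl s₁).trans (hA₁ col rfl)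
    have hedge : (run N compare s₁).A edge = s₁.A edge := run_A_of_not_writes rfl s₁
    rw [run, run_link hz₂, hc₂, hcmp]
    simp only [On, hrow, hcol, hedge]
    simp only [show (s₁.A edge a h = mark ↔ _) from h₁ a h,
      show (s.A row i a = mark ↔ _) from hs.row i a,
      show (s.A col i h = mark ↔ _) from hs.col i h]
    have hiff : (a < N ∧ h < N ∧ (i < n * m ∧ a = i / m) ∧ i < n * m ∧ h = i % m) ↔
        a < n ∧ h < m ∧ i = a * m + h := by
      constructor
      · rintro ⟨-, -, ⟨h1, rfl⟩, -, rfl⟩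
        have hm0 : 0 < m := by
          rcases Nat.eq_zero_or_pos m with rfl | h0
          · simp at h1
          · exact h0
        exact ⟨Nat.div_lt_of_lt_mul (by rwa [mul_comm]), Nat.mod_lt _ hm0,
          (Nat.div_add_mod' i m).symm⟩
      · rintro ⟨h1, h2, rfl⟩
        have h3 : a * m + h < n * m := by nlinarith
        have h4 : (a * m + h) / m = a := by
          rw [mul_comm, Nat.mul_add_div (by omega), Nat.div_eq_of_lt h2, add_zero]
        have h5 : (a * m + h) % m = h := by
          rw [mul_comm, Nat.mul_add_mod, Nat.mod_eq_of_lt h2]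
        exact ⟨by omega, by omega, ⟨h3, h4.symm⟩, h3, h5.symm⟩
    by_cases h2 : a < N ∧ h < N ∧ (i < n * m ∧ a = i / m) ∧ i < n * m ∧ h = i % m
    · rw [if_pos h2]
      obtain ⟨h4, h5, rfl⟩ := hiff.1 h2
      rw [if_pos (Nat.lt_succ_self _)]
      simp [h4, h5, SameUtility]
    · rw [if_neg h2]
      rw [hiff] at h2
      refine and_congr_right fun h4 => and_congr_right fun h5 => ?_
      have h6 : a * m + h < i + 1 ↔ a * m + h < i := by
        have : a * m + h ≠ i := fun h' => h2 ⟨h4, h5, h'.symm⟩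
        omega
      simp only [h6])
  refine (key a h).trans ?_
  refine and_congr_right fun h1 => and_congr_right fun h2 => ?_
  rw [if_pos (by nlinarith)]

theorem run_check {N : ℕ} {s : State Arr Var} (hz : s.v zero = 0) :
    On (run N check s).A ans 0 0 ↔
      On s.A ans 0 0 ∨ ∀ a < N, On s.A agents 0 a → On s.A asg 0 a := by
  have key := run_forEach_induction (N := N) (x := agent) (P := when agents zero agent
    (whenNot asg zero agent (set ok zero zero Γ'.blank))) (s := run N (set ok zero zero mark) s)
    (fun k A => On A ok 0 0 ↔ ∀ a < k, On s.A agents 0 a → On s.A asg 0 a)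
    (by simp [run, State.setA, hz]) (by
    intro i s₁ hi hA₁ hv₁ hvi h₁
    have hz₁ : s₁.v zero = 0 := (hv₁ zero (by decide) rfl).trans hz
    have h2 : s₁.A agents = s.A agents := (hA₁ agents rfl).trans (run_A_of_not_writes rfl s)
    have h3 : s₁.A asg = s.A asg := (hA₁ asg rfl).trans (run_A_of_not_writes rfl s)
    rw [run_when, hvi, hz₁, Nat.forall_lt_succ_right]
    split_ifs with h4
    · rw [run_whenNot, hvi, hz₁]
      rw [On, h2] at h4
      split_ifs with h5
      · rw [On, h3] at h5
        rw [h₁]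
        exact ⟨fun h => ⟨h, fun _ => h5⟩, fun h => h.1⟩
      · rw [On, h3] at h5
        simp [run, State.setA, hz₁, h4, h5, On]
    · rw [On, h2] at h4
      rw [h₁]
      simp [h4, On])
  set s₁ := run N (forEach agent (when agents zero agent
    (whenNot asg zero agent (set ok zero zero Γ'.blank)))) (run N (set ok zero zero mark) s)
    with hs₁
  have hz₁ : s₁.v zero = 0 :=
    (run_v_of_not_assigns rfl _).trans ((run_v_of_not_assigns rfl s).trans hz)
  have hans : s₁.A ans = s.A ans :=
    (run_A_of_not_writes rfl _).trans (run_A_of_not_writes rfl s)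
  have hrun : run N check s = run N (when ok zero zero (set ans zero zero mark)) s₁ := rfl
  rw [hrun, run_when, hz₁, ← key]
  split_ifs with h
  · exact iff_of_true (by simp [run, State.setA, hz₁]) (.inr h)
  · simp [On, hans, h]

/-- The answer is only ever switched on, so it accumulates a disjunction. The arrays are reused for
each candidate, so the invariant also says that their marks stay in range. All `c < N` are tried,
even those that are not the index of a utility. -/
theorem run_search {n m N : ℕ} {u : ℕ → List Γ'} {s : State Arr Var} (hz : s.v zero = 0)
    (hs : Parsed n m u s.A) (hnm : n * m ≤ N) (hn : n ≤ N) (hm : m < N)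
    (hblank : ∀ r i j, r = edge ∨ r = own ∨ r = price ∨ r = asg ∨ r = ans → s.A r i j = Γ'.blank) :
    On (run N search s).A ans 0 0 ↔ ∃ c < N, HasMatching n (Edge n m N s.A c) := by
  have hoff : ∀ r i j, r = edge ∨ r = own ∨ r = price ∨ r = asg ∨ r = ans → ¬On s.A r i j :=
    fun r i j hr => by simp [On, hblank r i j hr]
  refine (run_forEach_induction (N := N) (x := value) (P := edges ;; auction ;; check) (s := s)
    (fun k A => Small N A ∧ (∀ a h, On A edge a h → a < n ∧ h < m) ∧
      (On A ans 0 0 ↔ ∃ c < k, HasMatching n (Edge n m N s.A c)))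
    ⟨⟨fun a h h' => absurd h' (hoff _ _ _ (by simp)), fun a h h' => absurd h' (hoff _ _ _ (by simp)),
      fun a h' => absurd h' (hoff _ _ _ (by simp))⟩,
      fun a h h' => absurd h' (hoff _ _ _ (by simp)),
      ⟨fun h' => absurd h' (hoff _ _ _ (by simp)), by simp⟩⟩ ?_).2.2
  rintro i s₁ hi hA₁ hv₁ hvi ⟨h1, h2, h3⟩
  have hz₁ : s₁.v zero = 0 := (hv₁ zero (by decide) rfl).trans hz
  have hcont : s₁.A cont = s.A cont := hA₁ cont rfl
  have hs₁ : Parsed n m u s₁.A := by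
    refine ⟨fun c i => ?_, fun c a => ?_, fun c h => ?_, fun a => ?_⟩
    · rw [hcont]; exact hs.cont c i
    · rw [On, hA₁ row rfl]; exact hs.row c a
    · rw [On, hA₁ col rfl]; exact hs.col c h
    · rw [On, hA₁ agents rfl]; exact hs.agents a
  have hE : ∀ a h, On (run N edges s₁).A edge a h ↔ Edge n m N s.A i a h := fun a h => by
    rw [run_edges hz₁ hs₁ hnm hn hm.le h2 a h, hvi, Edge, SameUtility, hcont]; rfl
  set s₂ := run N edges s₁ with hs₂
  have hA₂ : ∀ r, edges.writes r = false → s₂.A r = s₁.A r := fun r hr =>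
    run_A_of_not_writes hr s₁
  have hz₂ : s₂.v zero = 0 := (run_v_of_not_assigns rfl s₁).trans hz₁
  have hsmall : Small N s₂.A := by
    refine ⟨fun a h => ?_, fun a h => ?_, fun a => ?_⟩
    · rw [On, hA₂ own rfl]; exact h1.own a h
    · rw [On, hA₂ price rfl]; exact h1.price a h
    · rw [On, hA₂ asg rfl]; exact h1.asg a
  obtain ⟨h4, h5⟩ := run_auction hz₂ hE (fun a h h' => ⟨h'.1, h'.2.1⟩) hn hm hsmall
  set s₃ := run N auction s₂ with hs₃
  have hA₃ : ∀ r, auction.writes r = false → s₃.A r = s₂.A r := fun r hr =>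
    run_A_of_not_writes hr s₂
  have hz₃ : s₃.v zero = 0 := (run_v_of_not_assigns rfl s₂).trans hz₂
  have h6 := run_check (N := N) hz₃
  have hA₄ : ∀ r, check.writes r = false → (run N check s₃).A r = s₃.A r := fun r hr =>
    run_A_of_not_writes hr s₃
  have hrun : run N (edges ;; auction ;; check) s₁ = run N check s₃ := rfl
  rw [hrun]
  refine ⟨⟨fun a h => ?_, fun a h => ?_, fun a => ?_⟩, fun a h => ?_, ?_⟩
  · rw [On, hA₄ own rfl]; exact h4.own a h
  · rw [On, hA₄ price rfl]; exact h4.price a h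
  · rw [On, hA₄ asg rfl]; exact h4.asg a
  · rw [On, hA₄ edge rfl, hA₃ edge rfl]
    exact fun h' => ⟨((hE a h).1 h').1, ((hE a h).1 h').2.1⟩
  · rw [h6, On, hA₃ ans rfl, hA₂ ans rfl, show (s₁.A ans 0 0 = mark ↔ _) from h3]
    have h7 : (∀ a < N, On s₃.A agents 0 a → On s₃.A asg 0 a) ↔
        HasMatching n (Edge n m N s.A i) := by
      rw [← h5]
      refine forall_congr' fun a => ?_
      rw [On, hA₃ agents rfl, hA₂ agents rfl,
        show (s₁.A agents 0 a = mark ↔ _) from hs₁.agents a]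
      constructor
      · exact fun h8 ha => h8 (ha.trans_le hn) ha
      · exact fun h8 _ ha => h8 ha
    rw [h7]
    constructor
    · rintro (⟨c, hc, h8⟩ | h8)
      · exact ⟨c, hc.trans (Nat.lt_succ_self i), h8⟩
      · exact ⟨i, Nat.lt_succ_self i, h8⟩
    · rintro ⟨c, hc, h8⟩
      rcases Nat.lt_succ_iff_lt_or_eq.1 hc with hc | rfl
      · exact .inl ⟨c, hc, h8⟩
      · exact .inr h8

end HouseProgram

end

/-! ### Parsing the input string -/

section

open Computability Function

namespace HouseProgram

open ArrayProgram ArrayProgram.Prog Arr Var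

/-- Sequential composition. -/
local infixr:60 " ;; " => Prog.seq

/-- Process a symbol of the input. -/
def parseSym : Γ' → Prog Arr Var
  | .bra => tst depth zero zero (· = Γ'.blank)
      (set depth zero zero Γ'.bra ;; reset house)
      (set depth zero zero Γ'.comma ;; reset off ;; set row cell agent mark ;;
        set col cell house mark ;; set agents zero agent mark)
  | .ket => tst depth zero zero (· = Γ'.comma)
      (set depth zero zero Γ'.bra ;; inc house ;; inc cell)
      (set depth zero zero Γ'.blank ;; inc agent)
  | c => tst depth zero zero (· = Γ'.comma) (set cont cell off c ;; inc off) skip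

/-- Store the utilities in the array `cont`, and their positions in `row` and `col`. -/
def parse : Prog Arr Var := forEach pos (switch inp zero pos parseSym)

/-- The effect of `parseSym`. -/
abbrev feed (N : ℕ) (s : State Arr Var) (c : Γ') : State Arr Var := run N (parseSym c) s

/-- Processing a symbol does not involve `pos`; therefore the loop over positions amounts to a fold
over the word. -/
theorem feed_setV (N : ℕ) (s : State Arr Var) (c : Γ') (k : ℕ) :
    feed N (s.setV pos k) c = (feed N s c).setV pos k := by
  have hu : ∀ (f : Var → ℕ) (x : Var) (i : ℕ), x ≠ pos →
      update (update f pos k) x i = update (update f x i) pos k := fun f x i hx =>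
    update_comm hx.symm _ _ _
  have e1 : (s.setV pos k).A = s.A := rfl
  have e2 : ∀ x, x ≠ pos → (s.setV pos k).v x = s.v x := fun x hx => by simp [State.setV, hx]
  cases c <;> simp only [feed, parseSym, run] <;> rw [e1, e2 zero (by decide)] <;> split_ifs <;>
    simp [State.setV, State.setA, hu]

theorem run_parse_eq_foldl {w : List Γ'} {s : State Arr Var} (hz : s.v zero = 0)
    (hw : ∀ i (h : i < w.length), s.A inp 0 i = w[i]) :
    (run w.length parse s).A = (w.foldl (feed w.length) s).A := by
  set N := w.length with hN
  -- Loop and fold agree except for the value `k` of `pos`.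
  have key : ∀ n ≤ N, ∃ k,
      iter (fun i s => run N (switch inp zero pos parseSym) (s.setV pos i)) n s =
        ((w.take n).foldl (feed N) s).setV pos k := by
    intro n
    induction n with
    | zero => exact fun _ => ⟨s.v pos, by simp [iter, State.setV]⟩
    | succ n ih =>
      intro hn
      obtain ⟨k, hk⟩ := ih (by omega)
      refine ⟨n, ?_⟩
      have hfold : ∀ (l : List Γ') (s : State Arr Var),
          (l.foldl (feed N) s).A inp = s.A inp ∧ (l.foldl (feed N) s).v zero = s.v zero := by
        intro l
        induction l with
        | nil => exact fun s => ⟨rfl, rfl⟩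
        | cons c l ih =>
          intro s
          rw [List.foldl_cons, (ih _).1, (ih _).2]
          exact ⟨run_A_of_not_writes (by cases c <;> rfl) s,
            run_v_of_not_assigns (by cases c <;> rfl) s⟩
      have hsym : (((w.take n).foldl (feed N) s).setV pos n).A inp
          ((((w.take n).foldl (feed N) s).setV pos n).v zero)
          ((((w.take n).foldl (feed N) s).setV pos n).v pos) = w[n] := by
        have h1 := hfold (w.take n) s
        simp only [State.setV, h1.1, update_self]
        rw [update_of_ne (by decide), h1.2, hz, hw n (by omega)]
      rw [iter, hk]
      have : (((w.take n).foldl (feed N) s).setV pos k).setV pos n =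
          ((w.take n).foldl (feed N) s).setV pos n := by simp [State.setV]
      rw [this, run_switch, hsym, ← List.take_concat_get' _ n (by omega), List.foldl_append,
        List.foldl_cons, List.foldl_nil, ← feed_setV]
  obtain ⟨k, hk⟩ := key N le_rfl
  rw [parse, run, hk, hN, List.take_length]
  rfl

/-- A string of bits and commas. -/
def IsFlat (l : List Γ') : Prop := ∀ c ∈ l, c = Γ'.comma ∨ ∃ b, c = Γ'.bit b

theorem feed_of_isFlat (N : ℕ) (s : State Arr Var) {c : Γ'}
    (hc : c = Γ'.comma ∨ ∃ b, c = Γ'.bit b) :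
    feed N s c = if s.A depth (s.v zero) (s.v zero) = Γ'.comma then
      (s.setA cont (s.v cell) (s.v off) c).setV off (min (s.v off + 1) N) else s := by
  rcases hc with rfl | ⟨b, rfl⟩ <;> simp [feed, parseSym, run, State.setA]

/-- Outside of brackets, bits and commas are skipped, so the binary numbers at the beginning are
never decoded. -/
theorem foldl_header (N : ℕ) {l : List Γ'} (hl : IsFlat l) {s : State Arr Var}
    (hz : s.v zero = 0) (hd : s.A depth 0 0 = Γ'.blank) : l.foldl (feed N) s = s := by
  induction l with
  | nil => rfl
  | cons c l ih =>
    rw [List.foldl_cons, feed_of_isFlat N s (hl c (by simp)), hz, hd, if_neg (by simp)]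
    exact ih fun c hc => hl c (by simp [hc])

theorem foldl_content {N : ℕ} {l : List Γ'} (hl : IsFlat l) {s : State Arr Var}
    (hz : s.v zero = 0) (hd : s.A depth 0 0 = Γ'.comma) (hoff : s.v off + l.length ≤ N) :
    l.foldl (feed N) s =
      ⟨fun r i j => if r = cont ∧ i = s.v cell ∧ s.v off ≤ j ∧ j < s.v off + l.length then
        l.getD (j - s.v off) Γ'.blank else s.A r i j, update s.v off (s.v off + l.length)⟩ := by
  induction l generalizing s with
  | nil =>
    ext1
    · funext r i j
      simp only [List.length_nil, add_zero]
      rw [if_neg (by omega)]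
      rfl
    · simp
  | cons c l ih =>
    simp only [List.length_cons] at hoff
    rw [List.foldl_cons, feed_of_isFlat N s (hl c (by simp)), hz, hd, if_pos rfl,
      min_eq_left (by omega), ih (fun c hc => hl c (by simp [hc]))]
    · ext1
      · funext r i j
        simp only [State.setV, State.setA, update_self, List.length_cons]
        rw [update_of_ne (by decide)]
        by_cases hr : r = cont ∧ i = s.v cell
        · simp only [hr.1, hr.2, true_and]
          rcases lt_trichotomy j (s.v off) with h | h | h
          · rw [if_neg (by omega), if_neg (by omega), if_neg (by omega)]
          · rw [if_neg (by omega), if_pos h, if_pos (by omega), h, Nat.sub_self]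
            rfl
          · have e : j - s.v off = (j - (s.v off + 1)) + 1 := by omega
            by_cases h2 : j < s.v off + (l.length + 1)
            · rw [if_pos (by omega), if_pos (by omega), e, List.getD_cons_succ]
            · rw [if_neg (by omega), if_neg (by omega), if_neg (by omega)]
        · rw [if_neg (by tauto), if_neg (by tauto), if_neg (by tauto)]
      · simp [State.setV, State.setA, add_assoc, add_comm]
    · simpa [State.setV, State.setA] using hz
    · simpa [State.setV, State.setA] using hd
    · simp only [State.setV, update_self]
      omega

/-- The string of a utility. -/
abbrev cellString (l : List Γ') : List Γ' := Γ'.bra :: (l ++ [Γ'.ket])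

theorem foldl_cellString {N a h c : ℕ} {l : List Γ'} (hl : IsFlat l) (hlen : l.length ≤ N)
    {s : State Arr Var} (hz : s.v zero = 0) (hd : s.A depth 0 0 = Γ'.bra) (ha : s.v agent = a)
    (hh : s.v house = h) (hc : s.v cell = c) (hhN : h < N) (hcN : c < N) :
    ((cellString l).foldl (feed N) s).A = (fun r i j =>
      if r = cont ∧ i = c ∧ j < l.length then l.getD j Γ'.blank else
        if (r = row ∧ i = c ∧ j = a) ∨ (r = col ∧ i = c ∧ j = h) ∨ (r = agents ∧ i = 0 ∧ j = a) then
          mark else s.A r i j) ∧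
      ((cellString l).foldl (feed N) s).v zero = 0 ∧
      ((cellString l).foldl (feed N) s).v agent = a ∧
      ((cellString l).foldl (feed N) s).v house = h + 1 ∧
      ((cellString l).foldl (feed N) s).v cell = c + 1 := by
  have h1 : feed N s Γ'.bra = ((((s.setA depth 0 0 Γ'.comma).setV off 0).setA row c a mark).setA
      col c h mark).setA agents 0 a mark := by
    simp [feed, parseSym, run, hz, hd, State.setV, State.setA, ha, hh, hc]
  rw [List.foldl_cons, List.foldl_append, h1,
    foldl_content hl (by simpa [State.setV, State.setA] using hz)
      (by simp [State.setV, State.setA]) (by simpa [State.setV, State.setA] using hlen)]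
  simp only [List.foldl_cons, List.foldl_nil, feed, parseSym, run, State.setV, State.setA]
  have hh' : min (h + 1) N = h + 1 := min_eq_left hhN
  have hc' : min (c + 1) N = c + 1 := min_eq_left hcN
  refine ⟨?_, ?_⟩
  · funext r i j
    by_cases hr : r = depth
    · subst hr
      by_cases hij : i = 0 ∧ j = 0
      · simp [hz, hij, hd]
      · simp [hz, hij]
    · cases r <;> simp [hz, hc] at hr ⊢
  · simp [hz, hh, ha, hc, hh', hc']

/-- The situation after `c` utilities have been read. -/
structure Progress (m : ℕ) (u : ℕ → List Γ') (c : ℕ) (A : Arrays) : Prop where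
  cont : ∀ c' i, A cont c' i = if c' < c then (u c').getD i Γ'.blank else Γ'.blank
  row : ∀ c' a, On A row c' a ↔ c' < c ∧ a = c' / m
  col : ∀ c' h, On A col c' h ↔ c' < c ∧ h = c' % m
  agents : ∀ a, On A agents 0 a ↔ ∃ c' < c, a = c' / m

theorem Progress.congr {m c : ℕ} {u : ℕ → List Γ'} {A B : Arrays} (h : Progress m u c A)
    (h1 : B Arr.cont = A Arr.cont) (h2 : B Arr.row = A Arr.row) (h3 : B Arr.col = A Arr.col)
    (h4 : B Arr.agents = A Arr.agents) : Progress m u c B := by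
  refine ⟨fun c i => ?_, fun c a => ?_, fun c a => ?_, fun a => ?_⟩
  · rw [h1]; exact h.cont c i
  · rw [On, h2]; exact h.row c a
  · rw [On, h3]; exact h.col c a
  · rw [On, h4]; exact h.agents a

theorem foldl_cells {N n m a k : ℕ} {u : ℕ → List Γ'} (hu : ∀ c < n * m, IsFlat (u c) ∧
    (u c).length ≤ N) (ha : a < n) (hm : m ≤ N) (hnm : n * m ≤ N) {s : State Arr Var}
    (hz : s.v zero = 0) (hd : s.A depth 0 0 = Γ'.bra) (hagent : s.v agent = a)
    (hhouse : s.v house = 0) (hcell : s.v cell = a * m) (hs : Progress m u (a * m) s.A)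
    (hk : k ≤ m) {s' : State Arr Var}
    (hs' : s' = ((List.range k).flatMap fun j => cellString (u (a * m + j))).foldl (feed N) s) :
    s'.v zero = 0 ∧ s'.A depth 0 0 = Γ'.bra ∧ s'.v agent = a ∧ s'.v house = k ∧
      s'.v cell = a * m + k ∧ Progress m u (a * m + k) s'.A := by
  induction k generalizing s' with
  | zero => subst hs'; exact ⟨hz, hd, hagent, hhouse, hcell, hs⟩
  | succ k ih =>
    obtain ⟨i1, i2, i3, i4, i5, i6⟩ := ih (by omega) rfl
    rw [List.range_succ, List.flatMap_append, List.foldl_append] at hs'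
    set t := ((List.range k).flatMap fun j => cellString (u (a * m + j))).foldl (feed N) s
    have hlt : a * m + k < n * m := by nlinarith
    obtain ⟨hflat, hlen⟩ := hu _ hlt
    obtain ⟨hA, j1, j2, j3, j4⟩ := foldl_cellString hflat hlen i1 i2 i3 i4 i5 (by omega) (by omega)
    simp only [List.flatMap_cons, List.flatMap_nil, List.append_nil] at hs'
    rw [← hs'] at hA j1 j2 j3 j4
    have hdiv : (a * m + k) / m = a := by
      rw [mul_comm, Nat.mul_add_div (by omega), Nat.div_eq_of_lt (by omega), add_zero]
    have hmod : (a * m + k) % m = k := by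
      rw [mul_comm, Nat.mul_add_mod, Nat.mod_eq_of_lt (by omega)]
    refine ⟨j1, by rw [hA]; simpa using i2, j2, j3, by rw [j4]; ring, ?_, ?_, ?_, ?_⟩
    · intro c' i
      rw [hA]
      simp only [true_and, reduceCtorEq, false_and, or_false, if_false]
      rw [i6.cont]
      by_cases hc : c' = a * m + k
      · subst hc
        by_cases hi : i < (u (a * m + k)).length
        · simp [hi]
        · simp [hi]
      · simp only [hc, false_and, if_false]
        congr 1
        exact propext (by omega)
    · intro c' b
      rw [On, hA]
      simp only [true_and, reduceCtorEq, false_and, or_false, if_false]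
      by_cases hc : c' = a * m + k ∧ b = a
      · simp [hc, hdiv]
      · rw [if_neg hc, show (t.A Arr.row c' b = mark ↔ _) from i6.row c' b]
        constructor
        · rintro ⟨h1, h2⟩; exact ⟨by omega, h2⟩
        · rintro ⟨h1, h2⟩
          refine ⟨?_, h2⟩
          by_contra h3
          obtain rfl : c' = a * m + k := by omega
          exact hc ⟨rfl, h2.trans hdiv⟩
    · intro c' b
      rw [On, hA]
      simp only [true_and, reduceCtorEq, false_and, or_false, false_or, if_false]
      by_cases hc : c' = a * m + k ∧ b = k
      · simp [hc, hmod]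
      · rw [if_neg hc, show (t.A Arr.col c' b = mark ↔ _) from i6.col c' b]
        constructor
        · rintro ⟨h1, h2⟩; exact ⟨by omega, h2⟩
        · rintro ⟨h1, h2⟩
          refine ⟨?_, h2⟩
          by_contra h3
          obtain rfl : c' = a * m + k := by omega
          exact hc ⟨rfl, h2.trans hmod⟩
    · intro b
      rw [On, hA]
      simp only [true_and, reduceCtorEq, false_and, false_or, if_false]
      by_cases hb : b = a
      · simp only [hb, if_true, true_iff]
        exact ⟨a * m + k, by omega, hdiv.symm⟩
      · rw [if_neg hb, show (t.A Arr.agents 0 b = mark ↔ _) from i6.agents b]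
        constructor
        · rintro ⟨c', h1, h2⟩; exact ⟨c', by omega, h2⟩
        · rintro ⟨c', h1, h2⟩
          refine ⟨c', ?_, h2⟩
          by_contra h3
          obtain rfl : c' = a * m + k := by omega
          exact hb (h2.trans hdiv)

/-- The string of the utilities of the agent `a`. -/
abbrev rowString (m : ℕ) (u : ℕ → List Γ') (a : ℕ) : List Γ' :=
  Γ'.bra :: (((List.range m).flatMap fun j => cellString (u (a * m + j))) ++ [Γ'.ket])

theorem foldl_rows {N n m k : ℕ} {u : ℕ → List Γ'} (hu : ∀ c < n * m, IsFlat (u c) ∧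
    (u c).length ≤ N) (hn : n ≤ N) (hm : m ≤ N) (hnm : n * m ≤ N) {s : State Arr Var}
    (hz : s.v zero = 0) (hd : s.A depth 0 0 = Γ'.blank) (hagent : s.v agent = 0)
    (hcell : s.v cell = 0) (hs : Progress m u 0 s.A) (hk : k ≤ n) {s' : State Arr Var}
    (hs' : s' = ((List.range k).flatMap (rowString m u)).foldl (feed N) s) :
    s'.v zero = 0 ∧ s'.A depth 0 0 = Γ'.blank ∧ s'.v agent = k ∧ s'.v cell = k * m ∧
      Progress m u (k * m) s'.A := by
  induction k generalizing s' with
  | zero => subst hs'; simpa using ⟨hz, hd, hagent, hcell, hs⟩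
  | succ k ih =>
    obtain ⟨i1, i2, i3, i4, i5⟩ := ih (by omega) rfl
    rw [List.range_succ, List.flatMap_append, List.foldl_append] at hs'
    set t := ((List.range k).flatMap (rowString m u)).foldl (feed N) s
    simp only [List.flatMap_cons, List.flatMap_nil, List.append_nil, rowString, List.foldl_cons,
      List.foldl_append, List.foldl_nil] at hs'
    have h1 : feed N t Γ'.bra = (t.setA depth 0 0 Γ'.bra).setV house 0 := by
      simp [feed, parseSym, run, i1, i2]
    rw [h1] at hs'
    obtain ⟨j1, j2, j3, j4, j5, j6⟩ := foldl_cells (N := N) (n := n) (m := m) (a := k) (k := m)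
      (u := u) (s := (t.setA depth 0 0 Γ'.bra).setV house 0) hu (by omega) hm hnm
      (by simpa [State.setA, State.setV] using i1) (by simp [State.setA, State.setV])
      (by simpa [State.setA, State.setV] using i3) (by simp [State.setV])
      (by simpa [State.setA, State.setV] using i4)
      (i5.congr (by funext i j; simp [State.setA, State.setV])
        (by funext i j; simp [State.setA, State.setV])
        (by funext i j; simp [State.setA, State.setV])
        (by funext i j; simp [State.setA, State.setV])) le_rfl rfl
    set t' := ((List.range m).flatMap fun j => cellString (u (k * m + j))).foldl (feed N)
      ((t.setA depth 0 0 Γ'.bra).setV house 0)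
    have h2 : feed N t' Γ'.ket = (t'.setA depth 0 0 Γ'.blank).setV agent (min (k + 1) N) := by
      simp [feed, parseSym, run, j1, j2, j3, State.setA]
    rw [h2, min_eq_left (by omega)] at hs'
    subst hs'
    refine ⟨by simpa [State.setA, State.setV] using j1, by simp [State.setA, State.setV],
      by simp [State.setV], ?_, ?_⟩
    · simp only [State.setA, State.setV]
      rw [update_of_ne (by decide), j5]
      ring
    · rw [Nat.succ_mul]
      exact j6.congr (by funext i j; simp [State.setA, State.setV])
        (by funext i j; simp [State.setA, State.setV])
        (by funext i j; simp [State.setA, State.setV])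
        (by funext i j; simp [State.setA, State.setV])

/-- An agent is registered when one of its utilities is read, so `hpos` is required: agents with
empty rows would remain unnoticed. -/
theorem run_parse {n m : ℕ} {u : ℕ → List Γ'} {w l : List Γ'}
    (hw : w = l ++ (List.range n).flatMap (rowString m u)) (hl : IsFlat l)
    (hu : ∀ c < n * m, IsFlat (u c) ∧ (u c).length ≤ w.length) (hn : n ≤ w.length)
    (hm : m ≤ w.length) (hnm : n * m ≤ w.length) (hpos : 0 < n → 0 < m) :
    Parsed n m u (run w.length parse (initial Var inp w)).A := by
  have hblank : ∀ r i j, r ≠ inp → (initial Var inp w).A r i j = Γ'.blank := fun r i j hr => by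
    simp [initial, hr]
  rw [run_parse_eq_foldl rfl (fun i hi => by
    simp [initial, hi])]
  rw [congrArg (List.foldl _ _) hw, List.foldl_append, foldl_header _ hl rfl (hblank _ _ _ (by decide))]
  obtain ⟨-, -, -, -, h⟩ := foldl_rows (N := w.length) (k := n) (s := initial Var inp w) hu hn hm
    hnm rfl (hblank _ _ _ (by decide)) rfl rfl
    ⟨fun c i => by rw [hblank _ _ _ (by decide)]; simp,
      fun c i => by rw [On, hblank _ _ _ (by decide)]; simp,
      fun c i => by rw [On, hblank _ _ _ (by decide)]; simp,
      fun c => by rw [On, hblank _ _ _ (by decide)]; simp⟩ le_rfl rfl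
  refine ⟨h.cont, h.row, h.col, fun a => (h.agents a).trans ⟨?_, fun ha => ?_⟩⟩
  · rintro ⟨c, hc, rfl⟩
    exact Nat.div_lt_of_lt_mul (by rwa [mul_comm])
  · have hm0 := hpos (by omega)
    refine ⟨a * m, Nat.mul_lt_mul_of_pos_right ha hm0, ?_⟩
    rw [Nat.mul_div_cancel _ hm0]

end HouseProgram

end

/-! ### Correctness on encoded instances and the matching criterion -/

section

open Computability Function

namespace HouseProgram

open ArrayProgram ArrayProgram.Prog Arr Var

/-- A flat string contains no blank, so the blank padding reveals where a string ends. -/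
theorem length_le_of_getD {N : ℕ} {l l' : List Γ'} (hl' : IsFlat l') (hN' : l'.length ≤ N)
    (h : ∀ i < N, l.getD i Γ'.blank = l'.getD i Γ'.blank) : l'.length ≤ l.length := by
  by_contra hlt
  have h1 := h l.length (by omega)
  rw [List.getD_eq_default _ _ le_rfl, List.getD_eq_getElem _ _ (by omega)] at h1
  have h2 := hl' _ (List.getElem_mem (l := l') (n := l.length) (by omega))
  rw [← h1] at h2
  simp at h2

theorem eq_of_getD {N : ℕ} {l l' : List Γ'} (hl : IsFlat l) (hl' : IsFlat l')
    (hN : l.length ≤ N) (hN' : l'.length ≤ N)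
    (h : ∀ i < N, l.getD i Γ'.blank = l'.getD i Γ'.blank) : l = l' := by
  have e : l.length = l'.length := le_antisymm (length_le_of_getD hl hN fun i hi => (h i hi).symm)
    (length_le_of_getD hl' hN' h)
  refine List.ext_getElem e fun i h1 h2 => ?_
  have := h i (by omega)
  rwa [List.getD_eq_getElem _ _ h1, List.getD_eq_getElem _ _ h2] at this

theorem isFlat_encodeBits (k : ℕ) : IsFlat (HouseInstance.encodeBits k) := fun c hc => by
  obtain ⟨b, -, rfl⟩ := List.mem_map.1 hc
  exact .inr ⟨b, rfl⟩

theorem IsFlat.append_comma {l l' : List Γ'} (hl : IsFlat l) (hl' : IsFlat l') :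
    IsFlat (l ++ Γ'.comma :: l') := by
  intro c hc
  rcases List.mem_append.1 hc with h | h
  · exact hl c h
  rcases List.mem_cons.1 h with h | h
  · exact .inl h
  · exact hl' c h

/-- The string of a utility, without its brackets. -/
def utilityString (q : ℚ≥0) : List Γ' :=
  HouseInstance.encodeBits q.num ++ Γ'.comma :: HouseInstance.encodeBits q.den

theorem isFlat_utilityString (q : ℚ≥0) : IsFlat (utilityString q) :=
  (isFlat_encodeBits _).append_comma (isFlat_encodeBits _)

theorem utilityString_ne_nil (q : ℚ≥0) : utilityString q ≠ [] := by simp [utilityString]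

theorem cellString_utilityString (q : ℚ≥0) :
    cellString (utilityString q) = HouseInstance.encodeUtility q := by
  simp [cellString, utilityString, HouseInstance.encodeUtility]

theorem utilityString_injective : Injective utilityString := fun p q h =>
  (HouseInstance.encodeUtility_append p q [] [] (by
    rw [← cellString_utilityString, h, cellString_utilityString])).1

/-- The strings of the utilities of an instance, row by row. -/
def utilities (I : HouseInstance) (c : ℕ) : List Γ' :=
  if h : c / I.m < I.n ∧ c % I.m < I.m then utilityString (I.u ⟨c / I.m, h.1⟩ ⟨c % I.m, h.2⟩) else []

theorem utilities_mul_add (I : HouseInstance) (a : Fin I.n) (h : Fin I.m) :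
    utilities I (a * I.m + h) = utilityString (I.u a h) := by
  have hm : 0 < I.m := h.pos
  have hdiv : (a * I.m + h) / I.m = a := by
    rw [mul_comm, Nat.mul_add_div hm, Nat.div_eq_of_lt h.2, add_zero]
  have hmod : (a * I.m + h) % I.m = h := by
    rw [mul_comm, Nat.mul_add_mod, Nat.mod_eq_of_lt h.2]
  simp only [utilities, hdiv, hmod]
  rw [dif_pos ⟨a.2, h.2⟩]

theorem mul_add_lt {n m : ℕ} (a : Fin n) (h : Fin m) : a * m + h < n * m := by
  have h1 := Nat.mul_le_mul_right m (show (a : ℕ) + 1 ≤ n from a.2)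
  have h2 := h.2
  rw [Nat.succ_mul] at h1
  omega

theorem exists_eq_mul_add {n m c : ℕ} (hc : c < n * m) :
    ∃ (a : Fin n) (h : Fin m), c = a * m + h := by
  have hm : 0 < m := Nat.pos_of_ne_zero fun h => by simp [h] at hc
  exact ⟨⟨c / m, Nat.div_lt_of_lt_mul (by rwa [mul_comm])⟩, ⟨c % m, Nat.mod_lt _ hm⟩,
    (Nat.div_add_mod' c m).symm⟩

theorem flatMap_ofFn {α : Type*} {n : ℕ} (v : Fin n → α) (f : α → List Γ') (g : ℕ → List Γ')
    (h : ∀ i : Fin n, f (v i) = g i) : (List.ofFn v).flatMap f = (List.range n).flatMap g := by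
  rw [List.ofFn_eq_map, List.flatMap_map, ← List.map_coe_finRange_eq_range, List.flatMap_map]
  exact List.flatMap_congr fun i _ => h i

/-- The part of the string of an instance before the utilities. -/
def header (I : HouseInstance) : List Γ' :=
  HouseInstance.encodeBits I.n ++ Γ'.comma :: (HouseInstance.encodeBits I.m ++ [Γ'.comma])

theorem isFlat_header (I : HouseInstance) : IsFlat (header I) :=
  (isFlat_encodeBits _).append_comma ((isFlat_encodeBits _).append_comma fun _ h => by simp at h)

theorem encode_eq (I : HouseInstance) :
    I.encode = header I ++ (List.range I.n).flatMap (rowString I.m (utilities I)) := by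
  rw [← flatMap_ofFn I.u HouseInstance.encodeRow]
  · simp [HouseInstance.encode, header]
  · intro a
    rw [HouseInstance.encodeRow, rowString, ← flatMap_ofFn (I.u a) HouseInstance.encodeUtility]
    intro h
    rw [utilities_mul_add, cellString_utilityString]

theorem mul_le_length_flatMap {f : ℕ → List Γ'} {b : ℕ} (k : ℕ) (h : ∀ j < k, b ≤ (f j).length) :
    k * b ≤ ((List.range k).flatMap f).length := by
  induction k with
  | zero => simp
  | succ k ih =>
    rw [List.range_succ, List.flatMap_append, List.length_append, Nat.succ_mul]
    exact Nat.add_le_add (ih fun j hj => h j (by omega)) (by simpa using h k (by omega))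

theorem length_le_length_flatMap {f : ℕ → List Γ'} {j k : ℕ} (hj : j < k) :
    (f j).length ≤ ((List.range k).flatMap f).length := by
  induction k with
  | zero => omega
  | succ k ih =>
    rw [List.range_succ, List.flatMap_append, List.length_append]
    rcases Nat.lt_succ_iff_lt_or_eq.1 hj with h | rfl
    · exact (ih h).trans (by omega)
    · simp

/-- The header has two commas, and each utility contributes a symbol. Thus the input length bounds
the indices of the utilities and, if there is an agent, strictly exceeds `m`. -/
theorem mul_add_two_le_length_encode (I : HouseInstance) :
    I.n * I.m + 2 ≤ I.encode.length := by
  rw [encode_eq, List.length_append]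
  have h1 : 2 ≤ (header I).length := by simp [header]; omega
  have h2 := mul_le_length_flatMap (f := rowString I.m (utilities I)) (b := I.m) I.n fun a _ => by
    have := mul_le_length_flatMap (f := fun j => cellString (utilities I (a * I.m + j))) (b := 1)
      I.m fun j _ => by simp [cellString]
    simp only [rowString, List.length_cons, List.length_append, List.length_nil]
    omega
  omega

theorem length_utilities_le (I : HouseInstance) {c : ℕ} (hc : c < I.n * I.m) :
    (utilities I c).length ≤ I.encode.length := by
  obtain ⟨a, h, rfl⟩ := exists_eq_mul_add hc
  have h1 := length_le_length_flatMap
    (f := fun j => cellString (utilities I (a * I.m + j))) h.2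
  have h2 := length_le_length_flatMap (f := rowString I.m (utilities I)) a.2
  rw [encode_eq, List.length_append]
  simp only [rowString, cellString, List.length_cons, List.length_append, List.length_nil] at h1 h2 ⊢
  omega

theorem isFlat_utilities (I : HouseInstance) (c : ℕ) : IsFlat (utilities I c) := by
  unfold utilities
  split_ifs
  · exact isFlat_utilityString _
  · exact fun _ h => by simp at h

theorem sameUtility_iff (I : HouseInstance) {N : ℕ} {A : Arrays}
    (hA : Parsed I.n I.m (utilities I) A) (hN : I.encode.length ≤ N)
    (a : Fin I.n) (h : Fin I.m) (b : Fin I.n) (h' : Fin I.m) :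
    SameUtility N A (a * I.m + h) (b * I.m + h') ↔ I.u a h = I.u b h' := by
  have e : SameUtility N A (a * I.m + h) (b * I.m + h') ↔ ∀ i < N,
      (utilityString (I.u a h)).getD i Γ'.blank = (utilityString (I.u b h')).getD i Γ'.blank := by
    simp only [SameUtility, hA.cont, mul_add_lt, if_true, utilities_mul_add]
  have hlen : ∀ a h, (utilityString (I.u a h)).length ≤ N := fun a h => by
    rw [← utilities_mul_add]
    exact (length_utilities_le I (mul_add_lt a h)).trans hN
  rw [e]
  exact ⟨fun he => utilityString_injective (eq_of_getD (isFlat_utilityString _)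
    (isFlat_utilityString _) (hlen _ _) (hlen _ _) he), fun he => by simp [he]⟩

/-- Beyond the last utility, `cont` is blank, whereas the string of a utility begins with a nonblank
symbol. So a number that is not the index of a utility has no edges. -/
theorem lt_of_sameUtility (I : HouseInstance) {N c : ℕ} {A : Arrays}
    (hA : Parsed I.n I.m (utilities I) A) (hN : 0 < N) {a : Fin I.n} {h : Fin I.m}
    (hs : SameUtility N A (a * I.m + h) c) : c < I.n * I.m := by
  by_contra hc
  have h0 := hs 0 hN
  rw [hA.cont, hA.cont, if_pos (mul_add_lt a h), if_neg hc, utilities_mul_add] at h0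
  have hpos := List.length_pos_iff.2 (utilityString_ne_nil (I.u a h))
  rw [List.getD_eq_getElem _ _ hpos] at h0
  have := isFlat_utilityString (I.u a h) _ (List.getElem_mem hpos)
  rw [h0] at this
  simp at this

/-- For an equitable assignment, the candidate is the index of the utility of the agent `0` for its
house. Conversely, an edge at the agent `0` forces `c` to be the index of a utility. -/
theorem exists_hasMatching_iff (I : HouseInstance) (hn : 0 < I.n) {A : Arrays}
    (hA : Parsed I.n I.m (utilities I) A) :
    (∃ c < I.encode.length, HasMatching I.n (Edge I.n I.m I.encode.length A c)) ↔
      I.HasEquitable := by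
  have hN := mul_add_two_le_length_encode I
  constructor
  · rintro ⟨c, -, φ, hφ, hinj⟩
    have hc : c < I.n * I.m := by
      obtain ⟨h1, h2, h3⟩ := hφ 0 hn
      exact lt_of_sameUtility I hA (a := ⟨0, hn⟩) (h := ⟨φ 0, h2⟩) (by omega) h3
    obtain ⟨b, h', rfl⟩ := exists_eq_mul_add hc
    refine ⟨⟨fun a => ⟨φ a, (hφ a a.2).2.1⟩, fun a a' haa => ?_⟩, fun a a' => ?_⟩
    · exact Fin.ext (hinj a a.2 a' a'.2 (congrArg Fin.val haa))
    · have key : ∀ a : Fin I.n, I.u a ⟨φ a, (hφ a a.2).2.1⟩ = I.u b h' := fun a =>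
        (sameUtility_iff I hA le_rfl a ⟨φ a, (hφ a a.2).2.1⟩ b h').1 (hφ a a.2).2.2
      exact (key a).trans (key a').symm
  · rintro ⟨φ, hφ⟩
    let b : Fin I.n := ⟨0, hn⟩
    have hlt := mul_add_lt b (φ b)
    refine ⟨b * I.m + φ b, by omega, fun a => if h : a < I.n then φ ⟨a, h⟩ else 0,
      fun a ha => ?_, fun a ha a' ha' he => ?_⟩
    · simp only [dif_pos ha]
      exact ⟨ha, (φ ⟨a, ha⟩).2,
        (sameUtility_iff I hA le_rfl ⟨a, ha⟩ (φ ⟨a, ha⟩) b (φ b)).2 (hφ _ _)⟩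
    · simp only [dif_pos ha, dif_pos ha'] at he
      exact congrArg Fin.val (φ.injective (Fin.ext he))

/-- The decision procedure. -/
def decision : Prog Arr Var := seq parse search

theorem run_decision (I : HouseInstance) :
    On (run I.encode.length decision (initial Var inp I.encode)).A ans 0 0 ↔ I.HasEquitable := by
  have hN := mul_add_two_le_length_encode I
  set s := run I.encode.length parse (initial Var inp I.encode)
  have hz : s.v zero = 0 := run_v_of_not_assigns (by rfl) _
  have hblank : ∀ r i j, r = edge ∨ r = own ∨ r = price ∨ r = asg ∨ r = ans →
      s.A r i j = Γ'.blank := by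
    rintro r i j (rfl | rfl | rfl | rfl | rfl) <;>
      exact congrFun₂ (run_A_of_not_writes (by rfl) (initial Var inp I.encode)) i j
  rcases Nat.eq_zero_or_pos I.n with hn | hn
  -- Without agents, `m` may exceed the length of the string, but the program never learns `m`. The
  -- arrays are those of an instance without houses, and the empty matching makes the answer
  -- positive.
  · have hs : Parsed 0 0 (utilities I) s.A := run_parse (l := header I)
      (by rw [encode_eq, hn]; simp) (isFlat_header I) (by simp) (by simp) (by simp) (by simp)
      (by simp)
    refine (run_search hz hs (by simp) (by simp) (by omega) hblank).trans ⟨fun _ => ?_, fun _ => ?_⟩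
    · have : IsEmpty (Fin I.n) := by rw [hn]; infer_instance
      exact ⟨⟨isEmptyElim, fun a => isEmptyElim a⟩, fun a => isEmptyElim a⟩
    · exact ⟨0, by omega, id, by simp, by simp⟩
  · have hm : I.m ≤ I.n * I.m := Nat.le_mul_of_pos_left _ hn
    have hnm := I.n_le_m
    have hs : Parsed I.n I.m (utilities I) s.A := run_parse (encode_eq I) (isFlat_header I)
      (fun c hc => ⟨isFlat_utilities I c, length_utilities_le I hc⟩) (by omega) (by omega)
      (by omega) (by omega)
    exact (run_search hz hs (by omega) (by omega) (by omega) hblank).trans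
      (exists_hasMatching_iff I hn hs)

end HouseProgram

namespace HouseInstance

open Classical in
theorem nonempty_computableInPolyTime : Nonempty (Turing.TM2ComputableInPolyTime encode
    Computability.encodeBool equitableDecision) :=
  ArrayProgram.nonempty_computableInPolyTime encode equitableDecision HouseProgram.decision
    (by rfl) .inp .ans (fun c => decide (c = ArrayProgram.mark)) fun I => by
      rw [equitableDecision]
      exact decide_eq_decide.2 (HouseProgram.run_decision I)

theorem utilityGraph_adj (I : HouseInstance) {k : ℚ≥0} {a : Fin I.n} {h : Fin I.m} :
    (I.utilityGraph k).Adj (.inl a) (.inr h) ↔ I.u a h = k := by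
  simp [utilityGraph]

/-- The subgraph of the utility graph of an assignment in which all agents have utility `k`. -/
def matching (I : HouseInstance) {k : ℚ≥0} (φ : I.Assignment) (hφ : ∀ a, I.u a (φ a) = k) :
    (I.utilityGraph k).Subgraph where
  verts := {x | (∃ a, x = .inl a) ∨ ∃ a, x = .inr (φ a)}
  Adj x y := ∃ a, x = .inl a ∧ y = .inr (φ a) ∨ y = .inl a ∧ x = .inr (φ a)
  adj_sub := by
    rintro x y ⟨a, ⟨rfl, rfl⟩ | ⟨rfl, rfl⟩⟩
    · exact I.utilityGraph_adj.2 (hφ a)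
    · exact (I.utilityGraph_adj.2 (hφ a)).symm
  edge_vert := by
    rintro x y ⟨a, ⟨rfl, rfl⟩ | ⟨rfl, rfl⟩⟩
    · exact .inl ⟨a, rfl⟩
    · exact .inr ⟨a, rfl⟩
  symm := ⟨by
    rintro x y ⟨a, h⟩
    exact ⟨a, h.symm⟩⟩

theorem isMatching_matching (I : HouseInstance) {k : ℚ≥0} (φ : I.Assignment)
    (hφ : ∀ a, I.u a (φ a) = k) : (I.matching φ hφ).IsMatching := by
  rintro x (⟨a, rfl⟩ | ⟨a, rfl⟩)
  · refine ⟨.inr (φ a), ⟨a, .inl ⟨rfl, rfl⟩⟩, ?_⟩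
    rintro y ⟨b, ⟨h, rfl⟩ | ⟨rfl, h⟩⟩
    · rw [Sum.inl.inj h]
    · cases h
  · refine ⟨.inl a, ⟨a, .inr ⟨rfl, rfl⟩⟩, ?_⟩
    rintro y ⟨b, ⟨h, rfl⟩ | ⟨rfl, h⟩⟩
    · cases h
    · rw [φ.injective (Sum.inr.inj h)]

/-- Edges of the graph lead from agents to houses only, and two agents with the same house would be
two partners of this house in `M`. -/
theorem exists_assignment_of_isMatching (I : HouseInstance) {k : ℚ≥0}
    {M : (I.utilityGraph k).Subgraph} (hM : M.IsMatching) (hverts : ∀ a, Sum.inl a ∈ M.verts) :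
    ∃ φ : I.Assignment, ∀ a, I.u a (φ a) = k := by
  have : ∀ a, ∃ h, M.Adj (.inl a) (.inr h) := fun a => by
    obtain ⟨y, hy, -⟩ := hM (hverts a)
    cases y with
    | inl b => simpa [utilityGraph] using M.adj_sub hy
    | inr h => exact ⟨h, hy⟩
  choose φ hφ using this
  refine ⟨⟨φ, fun a b hab => ?_⟩, fun a => I.utilityGraph_adj.1 (M.adj_sub (hφ a))⟩
  exact Sum.inl.inj ((hM (M.edge_vert (hφ a).symm)).unique (hφ a).symm (hab ▸ (hφ b).symm))

/-- The common utility is read off from the agent `0`. Without agents there is no value `k` at all,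
although the empty assignment is equitable. -/
theorem hasEquitable_iff (I : HouseInstance) (hn : 0 < I.n) : I.HasEquitable ↔
    ∃ k : ℚ≥0, (∃ a h, I.u a h = k) ∧
      ∃ M : (I.utilityGraph k).Subgraph, M.IsMatching ∧ ∀ a, Sum.inl a ∈ M.verts := by
  constructor
  · rintro ⟨φ, hφ⟩
    let a₀ : Fin I.n := ⟨0, hn⟩
    exact ⟨I.u a₀ (φ a₀), ⟨a₀, φ a₀, rfl⟩, I.matching φ fun a => hφ a a₀,
      I.isMatching_matching φ _, fun a => .inl ⟨a, rfl⟩⟩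
  · rintro ⟨k, -, M, hM, hverts⟩
    obtain ⟨φ, hφ⟩ := I.exists_assignment_of_isMatching hM hverts
    exact ⟨φ, fun a b => (hφ a).trans (hφ b).symm⟩

end HouseInstance

end

theorem mainTheorem8 :
    Nonempty (Turing.TM2ComputableInPolyTime HouseInstance.encode Computability.encodeBool
      HouseInstance.equitableDecision) ∧
    ∀ I : HouseInstance, 0 < I.n →
      (I.HasEquitable ↔
        ∃ k : ℚ≥0, (∃ a h, I.u a h = k) ∧
          ∃ M : (I.utilityGraph k).Subgraph, M.IsMatching ∧ ∀ a, Sum.inl a ∈ M.verts) :=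
  ⟨HouseInstance.nonempty_computableInPolyTime, HouseInstance.hasEquitable_iff⟩
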